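/- Let $d\ge 1$, let $(\Omega,P)$ be a probability space, and let $(\tau_x)_{x\in\mathbb R^d}$ be a measurable, measure-preserving, ergodic action of $\mathbb R^d$ on $\Omega$ such that the operators $(T_xf)(\omega)=f(\tau_{-x}\omega)$ form a strongly continuous group on $\mathscr H_0=L^2(\Omega,P;\mathbb C)$. Let $L_i$ be the generator of $t\mapsto T_{te_i}$, $\nabla=(L_1,\dots,L_d)$, and $\nabla^*\zeta=-\sum_iL_i\zeta_i$. Write $\langle\cdot\rangle$ for the expectation and let $\mathscr H=\mathscr H_0^d$ with inner product $\langle\xi\cdot\zeta\rangle=\sum_i\langle \xi_i\overline{\zeta_i}\rangle$. Let $$\mathscr H_\times=\{\xi\in\mathscr H: L_i\xi_j-L_j\xi_i=0 \text{ weakly for all } i,j,\ \langle\xi\rangle=0\},\qquad \mathscr H_\bullet=\{\zeta\in\mathscr H:\textstyle\sum_iL_i\zeta_i=0\text{ weakly},\ \langle\zeta\rangle=0\}.$$ Let $\Gamma$ be the bounded operator on $\mathscr H$ whose graph is the closure of the graph of $\nabla(\nabla^*\nabla)^{-1}\nabla^*$, and let $\Upsilon$ be the bounded operator whose graph is the closure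 of the graph of $K^*(KK^*)^{-1}K$, where $K\zeta=(L_i\zeta_j-L_j\zeta_i)_{i<j}$ is the curl (for $d=3$ this is $\nabla\!\times(\nabla\!\times\nabla\!\times)^{-1}\nabla\!\times$; the operators in parentheses are inverted modulo their kernels, which does not affect the result). Both operators exist. Let $R:\Omega\to SO(d)$ be measurable, $C=\mathrm{diag}(1,0,\dots,0)$, $X_1=R^TCR$ and $X_2=R^T(I-C)R$, acting on $\mathscr H$ by multiplication. For $\sigma_1,\sigma_2\in\mathbb C\setminus\{0\}$ with $h=\sigma_1/\sigma_2\notin(-\infty,0]$ let $z=1/h$, $\sigma=\sigma_1X_1+\sigma_2X_2$ and $\rho=\sigma^{-1}=X_1/\sigma_1+X_2/\sigma_2$. Then for all $E_0,J_0\in\mathbb C^d$ there is exactly one $E\in E_0+\mathscr H_\times$ with $\langle\sigma E\cdot\xi\rangle=0$ for all $\xi\in\mathscr H_\times$, and exactly one $J\in J_0+\mathscr H_\bullet$ with $\langle\rho J\cdot\zeta\rangle=0$ for all $\zeta\in\mathscr H_\bullet$, and there are matrices $\sigma^*,\rho^*$ with $\langle\sigma E\rangle=\sigma^*E_0$ and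 $\langle\rho J\rangle=\rho^*J_0$ for all $E_0,J_0$. For a matrix $M$ write $M_{jk}=Me_j\cdot e_k$. The matrices $m(h)=\sigma^*/\sigma_2$, $\tilde m(h)=\sigma_1\rho^*$ depend only on $h$, the matrices $w(z)=\sigma^*/\sigma_1$, $\tilde w(z)=\sigma_2\rho^*$ depend only on $z$, and all four are matrix-valued Herglotz functions: analytic on $\mathbb C\setminus(-\infty,0]$, with $\operatorname{Im}\,(f(h)\xi\cdot\xi)\ge0$ for $\operatorname{Im}h>0$ and $\xi\in\mathbb C^d$. The operators $X_1\Gamma X_1$, $X_2\Gamma X_2$, $X_2\Upsilon X_2$, $X_1\Upsilon X_1$ are self-adjoint on $\mathscr H$ with spectrum in $[0,1]$, and, for all $j,k$ and all $s,t\in\mathbb C\setminus[0,1]$, where $s=1/(1-h)$ and $t=1/(1-z)$, $$m_{jk}(h)=\delta_{jk}-F_{jk}(s),\quad F_{jk}(s)=\langle(sI-X_1\Gamma X_1)^{-1}X_1e_j\cdot e_k\rangle=\int_0^1\frac{d\mu_{jk}(\lambda)}{s-\lambda},$$ $$w_{jk}(z)=\delta_{jk}-G_{jk}(t),\quad G_{jk}(t)=\langle(tI-X_2\Gamma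 X_2)^{-1}X_2e_j\cdot e_k\rangle=\int_0^1\frac{d\alpha_{jk}(\lambda)}{t-\lambda},$$ $$\tilde m_{jk}(h)=\delta_{jk}-E_{jk}(s),\quad E_{jk}(s)=\langle(sI-X_2\Upsilon X_2)^{-1}X_2e_j\cdot e_k\rangle=\int_0^1\frac{d\eta_{jk}(\lambda)}{s-\lambda},$$ $$\tilde w_{jk}(z)=\delta_{jk}-H_{jk}(t),\quad H_{jk}(t)=\langle(tI-X_1\Upsilon X_1)^{-1}X_1e_j\cdot e_k\rangle=\int_0^1\frac{d\kappa_{jk}(\lambda)}{t-\lambda}.$$ Here $\mu_{jk},\alpha_{jk},\eta_{jk},\kappa_{jk}$ are finite real signed measures on $[0,1]$, positive for $j=k$, given by $d\langle Q(\lambda)X_ie_j\cdot e_k\rangle$, where $Q$ is the projection-valued spectral measure of the self-adjoint operator in the same line and $X_i$ is the projection occurring in that operator. -/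

import Mathlib

open MeasureTheory Filter Topology
open scoped ENNReal

namespace Polycrystal

noncomputable section

/-! ### Scalar and vector random fields -/

/-- The Hilbert space `L²(Ω, P)` of complex scalar fields. -/
abbrev H0 {Ω : Type*} [MeasurableSpace Ω] (P : Measure Ω) : Type _ := Lp ℂ 2 P

/-- The Hilbert space of `d`-tuples of elements of `L²(Ω, P)`, with inner product
`⟨ξ, ζ⟩ = ∑ i, ⟨ξ i, ζ i⟩`.  Mathlib's `inner ℂ ζ ξ` is linear in its second argument,
so that `⟨ξ · ζ⟩ = ∑ i, ∫ ξ i * conj (ζ i)` is `inner ℂ ζ ξ`. -/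
abbrev Hvec {Ω : Type*} [MeasurableSpace Ω] (P : Measure Ω) (d : ℕ) : Type _ :=
  PiLp 2 (fun _ : Fin d => H0 P)

section Fields

variable {Ω : Type*} [MeasurableSpace Ω] (P : Measure Ω) [IsProbabilityMeasure P] {d : ℕ}

/-- The constant (deterministic) vector field with value `c`. -/
def constField (c : Fin d → ℂ) : Hvec P d :=
  WithLp.toLp 2 (fun i => Lp.const 2 P (c i))

/-- The constant field `e_j`. -/
def basisField (j : Fin d) : Hvec P d := constField P (Pi.single j 1)

variable {P}

/-- The ensemble average `⟨ξ⟩` of a vector field. -/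
def mean (ξ : Hvec P d) : Fin d → ℂ := fun i => ∫ ω, ξ i ω ∂P

end Fields

/-! ### The translation group, its generators, and the weak differential conditions -/

section Calculus

variable {Ω : Type*} [MeasurableSpace Ω] (P : Measure Ω) {d : ℕ}
  [AddAction (Fin d → ℝ) Ω] [MeasurableConstVAdd (Fin d → ℝ) Ω]
  [VAddInvariantMeasure (Fin d → ℝ) Ω P]

/-- `(T_x f)(ω) = f(τ_{-x} ω)`, where `τ_x ω = x +ᵥ ω`. -/
def translate (x : Fin d → ℝ) (f : H0 P) : H0 P :=
  Lp.compMeasurePreserving (fun ω : Ω => (-x) +ᵥ ω) (measurePreserving_vadd (-x) P) f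

variable {P}

/-- `f` lies in the domain of the generator `L_i`, and `L_i f = g`: the derivative at `0`
of `t ↦ T_{t e_i} f`, in the sense of convergence in `L²(Ω, P)`, is `g`. -/
def IsPartial (i : Fin d) (f g : H0 P) : Prop :=
  HasDerivAt (fun t : ℝ => translate P (Pi.single i t : Fin d → ℝ) f) g 0

/-- `f` lies in the domains of all `L_i`, and `∇ f = (L_1 f, …, L_d f) = g`. -/
def IsGrad (f : H0 P) (g : Hvec P d) : Prop := ∀ i, IsPartial i f (g i)

/-- All components of `ξ` lie in the domains of all `L_j`, and `D i j = L_j ξ_i`. -/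
def IsJacobian (ξ : Hvec P d) (D : Fin d → Hvec P d) : Prop := ∀ i, IsGrad (ξ i) (D i)

/-- The space of mean-zero scalar fields `f` for which all `L_i L_j f` exist in `L²`. -/
def MemH2 (d : ℕ) [AddAction (Fin d → ℝ) Ω] [MeasurableConstVAdd (Fin d → ℝ) Ω]
    [VAddInvariantMeasure (Fin d → ℝ) Ω P] (f : H0 P) : Prop :=
  (∫ ω, f ω ∂P) = 0 ∧
    ∃ (g : Hvec P d) (D : Fin d → Hvec P d), IsGrad f g ∧ IsJacobian g D

/-- `L_i ξ_j - L_j ξ_i = 0` weakly, for all `i`, `j`. -/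
def IsCurlFree (ξ : Hvec P d) : Prop :=
  ∀ (φ : H0 P) (g : Hvec P d), IsGrad φ g →
    ∀ i j, inner ℂ (g i) (ξ j) = inner ℂ (g j) (ξ i)

/-- `∑ i, L_i ζ_i = 0` weakly. -/
def IsDivFree (ζ : Hvec P d) : Prop :=
  ∀ (φ : H0 P) (g : Hvec P d), IsGrad φ g → inner ℂ g ζ = 0

/-- The space of weakly curl-free fields of mean zero. -/
def curlFreeSpace (P : Measure Ω) (d : ℕ)
    [AddAction (Fin d → ℝ) Ω] [MeasurableConstVAdd (Fin d → ℝ) Ω]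
    [VAddInvariantMeasure (Fin d → ℝ) Ω P] : Set (Hvec P d) :=
  {ξ | IsCurlFree ξ ∧ mean ξ = 0}

/-- The space of weakly divergence-free fields of mean zero. -/
def divFreeSpace (P : Measure Ω) (d : ℕ)
    [AddAction (Fin d → ℝ) Ω] [MeasurableConstVAdd (Fin d → ℝ) Ω]
    [VAddInvariantMeasure (Fin d → ℝ) Ω P] : Set (Hvec P d) :=
  {ζ | IsDivFree ζ ∧ mean ζ = 0}

/-! ### The operators `Γ` and `Υ` -/

/-- `η = ∇ (∇* ∇)⁻¹ ∇* ζ`, where `∇* ζ = - ∑ i, L_i ζ_i`: `η = ∇ u`, where the mean-zero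
function `u` solves `∑ i, L_i L_i u = ∑ i, L_i ζ_i`. -/
def IsGradProj (ζ η : Hvec P d) : Prop :=
  ∃ (u : H0 P) (Dη Dζ : Fin d → Hvec P d),
    (∫ ω, u ω ∂P) = 0 ∧ IsGrad u η ∧ IsJacobian η Dη ∧ IsJacobian ζ Dζ ∧
      ∑ i, Dη i i = ∑ i, Dζ i i

/-- `η = K* (K K*)⁻¹ K ζ`, where `K ζ = (L_i ζ_j - L_j ζ_i)_{i, j}` is the curl, and
`(K* v)_j = - ∑ i, L_i v_{i j}` for antisymmetric `v`: `η = K* v` where `K (K* v) = K ζ`.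
(Two such `v` have the same `K* v`, since `K (K* w) = 0` forces `‖K* w‖² = 0`.) In three
dimensions this is `∇× (∇× ∇×)⁻¹ ∇×`, see `isCurlProj_three`; for two dimensions see
`isCurlProj_two`. -/
def IsCurlProj (ζ η : Hvec P d) : Prop :=
  ∃ (v : Fin d → Fin d → H0 P) (Dv : Fin d → Fin d → Hvec P d) (Dη Dζ : Fin d → Hvec P d),
    (∀ i j, v i j = - v j i) ∧ (∀ i j, MemH2 d (v i j)) ∧ (∀ i j, IsGrad (v i j) (Dv i j)) ∧
      (∀ j, η j = - ∑ i, Dv i j i) ∧ IsJacobian η Dη ∧ IsJacobian ζ Dζ ∧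
      ∀ i j, Dη j i - Dη i j = Dζ j i - Dζ i j

/-- `Γ` is the bounded operator `∇ (∇* ∇)⁻¹ ∇*`, that is, its graph is the closure of the
graph of that (densely defined) operator. -/
def IsGamma (Γ : Hvec P d →L[ℂ] Hvec P d) : Prop :=
  {p : Hvec P d × Hvec P d | p.2 = Γ p.1} =
    closure {p : Hvec P d × Hvec P d | IsGradProj p.1 p.2}

/-- `Υ` is the bounded operator `K* (K K*)⁻¹ K`, `K` the curl. -/
def IsUpsilon (Υ : Hvec P d →L[ℂ] Hvec P d) : Prop :=
  {p : Hvec P d × Hvec P d | p.2 = Υ p.1} =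
    closure {p : Hvec P d × Hvec P d | IsCurlProj p.1 p.2}

/-! ### Uniaxial polycrystals -/

end Calculus

/-- A random rotation matrix `R(ω)`, the crystal orientation at the origin; the orientation
at `x` is `R(τ_{-x} ω)`. -/
structure Orientation (Ω : Type*) [MeasurableSpace Ω] (d : ℕ) where
  /-- the rotation -/
  rot : Ω → Matrix.specialOrthogonalGroup (Fin d) ℝ
  measurable_entry : ∀ i j, Measurable fun ω => (rot ω : Matrix (Fin d) (Fin d) ℝ) i j

section Medium

variable {Ω : Type*} [MeasurableSpace Ω] {d : ℕ}

/-- The matrix `Rᵀ diag(v) R`. -/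
def Orientation.conj (R : Orientation Ω d) (v : Fin d → ℝ) (ω : Ω) : Matrix (Fin d) (Fin d) ℝ :=
  (R.rot ω : Matrix (Fin d) (Fin d) ℝ).transpose * Matrix.diagonal v * (R.rot ω)

variable (P : Measure Ω)

theorem Orientation.memLp_conj [IsProbabilityMeasure P] (R : Orientation Ω d) (v : Fin d → ℝ) (i j : Fin d) :
    MemLp (fun ω => ((R.conj v ω i j : ℝ) : ℂ)) ∞ P := by
  have hform : ∀ ω, R.conj v ω i j =
      ∑ k, (R.rot ω : Matrix (Fin d) (Fin d) ℝ) k i * v k *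
        (R.rot ω : Matrix (Fin d) (Fin d) ℝ) k j := by
    intro ω
    simp [Orientation.conj, Matrix.mul_apply, Matrix.diagonal_apply]
  have hle : ∀ ω k l, ‖(R.rot ω : Matrix (Fin d) (Fin d) ℝ) k l‖ ≤ 1 := fun ω k l =>
    entry_norm_bound_of_unitary (Matrix.mem_specialUnitaryGroup_iff.1 (R.rot ω).2).1 k l
  refine memLp_top_of_bound (C := ∑ k, ‖v k‖) ?_ (ae_of_all _ fun ω => ?_)
  · refine (Complex.measurable_ofReal.comp ?_).aestronglyMeasurable
    simp only [hform]
    exact Finset.measurable_sum _ fun k _ =>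
      ((R.measurable_entry k i).mul_const _).mul (R.measurable_entry k j)
  · rw [Complex.norm_real, hform]
    refine (norm_sum_le _ _).trans (Finset.sum_le_sum fun k _ => ?_)
    rw [norm_mul, norm_mul]
    have h1 := hle ω k i
    have h2 := hle ω k j
    calc _ ≤ 1 * ‖v k‖ * 1 := by gcongr
      _ = ‖v k‖ := by ring

variable [IsProbabilityMeasure P]

/-- Multiplication of scalar fields by a bounded function. -/
def mulOp (f : Ω → ℂ) (hf : MemLp f ∞ P) : H0 P →L[ℂ] H0 P :=
  (ContinuousLinearMap.mul ℂ ℂ).holderL P ∞ 2 2 (hf.toLp f)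

/-- Multiplication of vector fields by the matrix field `Rᵀ diag(v) R`. -/
def Orientation.op (R : Orientation Ω d) (v : Fin d → ℝ) : Hvec P d →L[ℂ] Hvec P d :=
  ((PiLp.continuousLinearEquiv 2 ℂ (fun _ : Fin d => H0 P)).symm : _ →L[ℂ] Hvec P d) ∘L
    ContinuousLinearMap.pi fun i =>
      ∑ j, (mulOp P _ (R.memLp_conj P v i j)) ∘L PiLp.proj 2 (fun _ : Fin d => H0 P) j

variable [NeZero d]

/-- The projection `X₁ = Rᵀ C R` with `C = diag(1, 0, …, 0)`. -/
def X1 (R : Orientation Ω d) : Hvec P d →L[ℂ] Hvec P d := R.op P (Pi.single 0 1)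

/-- The projection `X₂ = Rᵀ (I - C) R` with `C = diag(1, 0, …, 0)`. -/
def X2 (R : Orientation Ω d) : Hvec P d →L[ℂ] Hvec P d := R.op P (1 - Pi.single 0 1)

/-- The local conductivity `σ = σ₁ X₁ + σ₂ X₂`. -/
def conductivity (R : Orientation Ω d) (σ₁ σ₂ : ℂ) : Hvec P d →L[ℂ] Hvec P d :=
  σ₁ • X1 P R + σ₂ • X2 P R

/-- The local resistivity `ρ = σ⁻¹ = X₁ / σ₁ + X₂ / σ₂`. -/
def resistivity (R : Orientation Ω d) (σ₁ σ₂ : ℂ) : Hvec P d →L[ℂ] Hvec P d :=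
  σ₁⁻¹ • X1 P R + σ₂⁻¹ • X2 P R

variable [AddAction (Fin d → ℝ) Ω] [MeasurableConstVAdd (Fin d → ℝ) Ω]
  [VAddInvariantMeasure (Fin d → ℝ) Ω P]

/-- `E = E₀ + E_f` with `E_f` curl-free of mean zero and `⟨σ E · ξ⟩ = 0` for all curl-free `ξ`
of mean zero. -/
def IsElectricField (R : Orientation Ω d) (σ₁ σ₂ : ℂ) (E₀ : Fin d → ℂ) (E : Hvec P d) : Prop :=
  (∃ Ef ∈ curlFreeSpace P d, E = constField P E₀ + Ef) ∧
    ∀ ξ ∈ curlFreeSpace P d, inner ℂ ξ (conductivity P R σ₁ σ₂ E) = 0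

/-- `J = J₀ + J_f` with `J_f` divergence-free of mean zero and `⟨ρ J · ζ⟩ = 0` for all
divergence-free `ζ` of mean zero. -/
def IsCurrentField (R : Orientation Ω d) (σ₁ σ₂ : ℂ) (J₀ : Fin d → ℂ) (J : Hvec P d) : Prop :=
  (∃ Jf ∈ divFreeSpace P d, J = constField P J₀ + Jf) ∧
    ∀ ζ ∈ divFreeSpace P d, inner ℂ ζ (resistivity P R σ₁ σ₂ J) = 0

/-- `S` is the effective conductivity matrix `σ*`: for every `E₀` there is exactly one electric
field `E` of mean `E₀`, and the current `J = σ E` satisfies `⟨J⟩ = σ* E₀`. -/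
def IsEffectiveConductivity (R : Orientation Ω d) (σ₁ σ₂ : ℂ)
    (S : Matrix (Fin d) (Fin d) ℂ) : Prop :=
  ∀ E₀ : Fin d → ℂ, ∃ E : Hvec P d, (∀ E', IsElectricField P R σ₁ σ₂ E₀ E' ↔ E' = E) ∧
    mean (conductivity P R σ₁ σ₂ E) = S.mulVec E₀

/-- `S` is the effective resistivity matrix `ρ*`: for every `J₀` there is exactly one current
field `J` of mean `J₀`, and the electric field `E = ρ J` satisfies `⟨E⟩ = ρ* J₀`. -/
def IsEffectiveResistivity (R : Orientation Ω d) (σ₁ σ₂ : ℂ)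
    (S : Matrix (Fin d) (Fin d) ℂ) : Prop :=
  ∀ J₀ : Fin d → ℂ, ∃ J : Hvec P d, (∀ J', IsCurrentField P R σ₁ σ₂ J₀ J' ↔ J' = J) ∧
    mean (resistivity P R σ₁ σ₂ J) = S.mulVec J₀

end Medium

/-! ### Herglotz functions, spectral measures and Stieltjes representations -/

/-- `f` is a matrix-valued Herglotz function, analytic off the negative real axis. -/
def IsHerglotz {d : ℕ} (f : ℂ → Matrix (Fin d) (Fin d) ℂ) : Prop :=
  (∀ i j, DifferentiableOn ℂ (fun h => f h i j) Complex.slitPlane) ∧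
    ∀ h : ℂ, 0 < h.im → ∀ ξ : Fin d → ℂ, 0 ≤ (star ξ ⬝ᵥ (f h).mulVec ξ).im

/-- `Q` is the projection-valued spectral measure (resolution of the identity
`Q(λ) = Q((-∞, λ])`) of the bounded operator `T`, that is, `T = ∫ λ dQ(λ)` weakly. -/
structure IsSpectralMeasure {H : Type*} [NormedAddCommGroup H] [InnerProductSpace ℂ H]
    [CompleteSpace H] (T : H →L[ℂ] H) (Q : Set ℝ → H →L[ℂ] H) : Prop where
  isStarProjection : ∀ A, MeasurableSet A → IsStarProjection (Q A)
  univ : Q Set.univ = 1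
  iUnion : ∀ A : ℕ → Set ℝ, (∀ n, MeasurableSet (A n)) → Pairwise (Function.onFun Disjoint A) →
    ∀ ψ, HasSum (fun n => Q (A n) ψ) (Q (⋃ n, A n) ψ)
  integral : ∀ ψ, ∃ ν : Measure ℝ, IsFiniteMeasure ν ∧
    (∀ A, MeasurableSet A → ((ν.real A : ℝ) : ℂ) = inner ℂ ψ (Q A ψ)) ∧
    Integrable (fun l : ℝ => (l : ℂ)) ν ∧ inner ℂ ψ (T ψ) = ∫ l, (l : ℂ) ∂ν

/-- `T` is self-adjoint with spectrum in `[0, 1]`, and, with its spectral measure `Q` and the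
signed (for `j = k` positive) measures `dμ_{jk}(λ) = d⟨Q(λ) X e_j · e_k⟩`,
`f_{jk}(h) = δ_{jk} - ⟨(s - T)⁻¹ X e_j · e_k⟩ = δ_{jk} - ∫_0^1 dμ_{jk}(λ) / (s - λ)`
for all `s ∈ ℂ \ [0, 1]` and `h = 1 - 1 / s`, that is `s = 1 / (1 - h)`.
The component `M_{jk} = M e_j · e_k` of a matrix is its entry `M k j`. -/
def HasStieltjesRepresentation {Ω : Type*} [MeasurableSpace Ω] (P : Measure Ω)
    [IsProbabilityMeasure P] {d : ℕ} (X T : Hvec P d →L[ℂ] Hvec P d)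
    (f : ℂ → Matrix (Fin d) (Fin d) ℂ) : Prop :=
  IsSelfAdjoint T ∧ spectrum ℂ T ⊆ Complex.ofReal '' Set.Icc 0 1 ∧
  ∃ Q : Set ℝ → Hvec P d →L[ℂ] Hvec P d, IsSpectralMeasure T Q ∧ Q (Set.Icc 0 1) = 1 ∧
  ∃ μ : Fin d → Fin d → SignedMeasure ℝ,
    (∀ j k A, MeasurableSet A →
      ((μ j k A : ℝ) : ℂ) = inner ℂ (basisField P k) (Q A (X (basisField P j)))) ∧
    (∀ k, 0 ≤ μ k k) ∧
    ∀ s : ℂ, s ∉ Complex.ofReal '' Set.Icc 0 1 → ∀ j k,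
      f (1 - 1 / s) k j = (if j = k then 1 else 0) -
        inner ℂ (basisField P k) (resolvent T s (X (basisField P j))) ∧
      inner ℂ (basisField P k) (resolvent T s (X (basisField P j))) =
        ∫ᵛ l in Set.Icc (0 : ℝ) 1, 1 / (s - (l : ℂ)) ∂<•(μ j k)

/-! ### The curl in two and three dimensions -/

section Curl

variable {Ω : Type*} [MeasurableSpace Ω] {P : Measure Ω}

section Aux

variable {d : ℕ} [AddAction (Fin d → ℝ) Ω] [MeasurableConstVAdd (Fin d → ℝ) Ω]
  [VAddInvariantMeasure (Fin d → ℝ) Ω P]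

theorem IsGrad.neg {f : H0 P} {g : Hvec P d} (h : IsGrad f g) : IsGrad (-f) (-g) := by
  intro i
  have h1 : HasDerivAt (fun t : ℝ => -translate P (Pi.single i t : Fin d → ℝ) f) (-(g i)) 0 :=
    HasDerivAt.fun_neg (h i)
  have h2 : (fun t : ℝ => translate P (Pi.single i t : Fin d → ℝ) (-f)) =
      fun t : ℝ => -translate P (Pi.single i t : Fin d → ℝ) f := by
    funext t
    exact map_neg _ f
  show HasDerivAt (fun t : ℝ => translate P (Pi.single i t : Fin d → ℝ) (-f)) (-(g i)) 0
  rw [h2]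
  exact h1

theorem IsGrad.zero : IsGrad (0 : H0 P) (0 : Hvec P d) := by
  intro i
  have h2 : (fun t : ℝ => translate P (Pi.single i t : Fin d → ℝ) 0) = fun _ => 0 := by
    funext t
    exact map_zero _
  show HasDerivAt (fun t : ℝ => translate P (Pi.single i t : Fin d → ℝ) 0) 0 0
  rw [h2]
  exact hasDerivAt_const _ _

theorem IsGrad.unique {f : H0 P} {g g' : Hvec P d} (h : IsGrad f g) (h' : IsGrad f g') :
    g = g' := by
  ext1 i
  exact HasDerivAt.unique (h i) (h' i)

theorem MemH2.neg {f : H0 P} (h : MemH2 d f) : MemH2 d (-f) := by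
  obtain ⟨h0, g, D, hg, hD⟩ := h
  refine ⟨?_, -g, fun i => -D i, hg.neg, fun i => (hD i).neg⟩
  rw [integral_congr_ae (Lp.coeFn_neg f)]
  simp [integral_neg, h0]

theorem MemH2.zero : MemH2 d (0 : H0 P) := by
  refine ⟨?_, 0, fun _ => 0, IsGrad.zero, fun i => IsGrad.zero⟩
  rw [integral_congr_ae (Lp.coeFn_zero ℂ 2 P)]
  simp

end Aux

section Three

variable [AddAction (Fin 3 → ℝ) Ω] [MeasurableConstVAdd (Fin 3 → ℝ) Ω]
  [VAddInvariantMeasure (Fin 3 → ℝ) Ω P]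

/-- In three dimensions, `∇× ξ` in terms of `D i j = L_j ξ_i`. -/
def curl3 (D : Fin 3 → Hvec P 3) : Fin 3 → H0 P :=
  ![D 2 1 - D 1 2, D 0 2 - D 2 0, D 1 0 - D 0 1]

theorem isCurlProj_three (ζ η : Hvec P 3) :
    IsCurlProj ζ η ↔ ∃ (v : Hvec P 3) (Dv Dη Dζ : Fin 3 → Hvec P 3),
      (∀ i, MemH2 3 (v i)) ∧ IsJacobian v Dv ∧ (∀ i, η i = curl3 Dv i) ∧
      IsJacobian η Dη ∧ IsJacobian ζ Dζ ∧ curl3 Dη = curl3 Dζ := by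
  constructor
  · rintro ⟨v, Dv, Dη, Dζ, hanti, hH2, hgrad, hη, hJη, hJζ, hc⟩
    have hself : ∀ i, Dv i i = 0 := fun i => by
      have h2 : (2 : ℂ) • v i i = 0 := by
        rw [two_smul]
        exact eq_neg_iff_add_eq_zero.1 (hanti i i)
      have h0 : v i i = 0 := (smul_eq_zero.1 h2).resolve_left two_ne_zero
      have h1 := hgrad i i
      rw [h0] at h1
      exact h1.unique IsGrad.zero
    have hD : ∀ i j, Dv i j = - Dv j i := fun i j => by
      have h1 := (hgrad j i).neg
      rw [← hanti i j] at h1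
      exact (hgrad i j).unique h1
    refine ⟨WithLp.toLp 2 ![v 1 2, v 2 0, v 0 1], ![Dv 1 2, Dv 2 0, Dv 0 1], Dη, Dζ, ?_, ?_, ?_,
      hJη, hJζ, ?_⟩
    · intro i
      fin_cases i
      exacts [hH2 1 2, hH2 2 0, hH2 0 1]
    · intro i
      fin_cases i
      exacts [hgrad 1 2, hgrad 2 0, hgrad 0 1]
    · intro i
      rw [hη i, Fin.sum_univ_three]
      fin_cases i
      · simp [curl3, hself, hD 1 0]
        abel
      · simp [curl3, hself, hD 2 1]
        abel
      · simp [curl3, hself, hD 0 2]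
        abel
    · ext1 i
      fin_cases i
      exacts [hc 1 2, hc 2 0, hc 0 1]
  · rintro ⟨v, Dv, Dη, Dζ, hH2, hJ, hη, hJη, hJζ, hc⟩
    have hc0 : Dη 2 1 - Dη 1 2 = Dζ 2 1 - Dζ 1 2 := congrFun hc 0
    have hc1 : Dη 0 2 - Dη 2 0 = Dζ 0 2 - Dζ 2 0 := congrFun hc 1
    have hc2 : Dη 1 0 - Dη 0 1 = Dζ 1 0 - Dζ 0 1 := congrFun hc 2
    refine ⟨![![0, v 2, -v 1], ![-v 2, 0, v 0], ![v 1, -v 0, 0]],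
      ![![0, Dv 2, -Dv 1], ![-Dv 2, 0, Dv 0], ![Dv 1, -Dv 0, 0]], Dη, Dζ, ?_, ?_, ?_, ?_,
      hJη, hJζ, ?_⟩
    · intro i j
      fin_cases i <;> fin_cases j <;> simp
    · intro i j
      fin_cases i <;> fin_cases j
      exacts [MemH2.zero, hH2 2, (hH2 1).neg, (hH2 2).neg, MemH2.zero, hH2 0, hH2 1,
        (hH2 0).neg, MemH2.zero]
    · intro i j
      fin_cases i <;> fin_cases j
      exacts [IsGrad.zero, hJ 2, (hJ 1).neg, (hJ 2).neg, IsGrad.zero, hJ 0, hJ 1,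
        (hJ 0).neg, IsGrad.zero]
    · intro j
      rw [hη j, Fin.sum_univ_three]
      fin_cases j
      · simp [curl3]
        abel
      · simp [curl3]
        abel
      · simp [curl3]
        abel
    · intro i j
      fin_cases i <;> fin_cases j
      · simp
      · exact hc2
      · rw [← neg_sub, ← neg_sub (Dζ _ _)]; exact congrArg Neg.neg hc1
      · rw [← neg_sub, ← neg_sub (Dζ _ _)]; exact congrArg Neg.neg hc2
      · simp
      · exact hc0
      · exact hc1
      · rw [← neg_sub, ← neg_sub (Dζ _ _)]; exact congrArg Neg.neg hc0
      · simp

end Three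

section Two

variable [AddAction (Fin 2 → ℝ) Ω] [MeasurableConstVAdd (Fin 2 → ℝ) Ω]
  [VAddInvariantMeasure (Fin 2 → ℝ) Ω P]

/-- In two dimensions the curl is `∇× ξ = L_1 ξ_2 - L_2 ξ_1`, with adjoint
`u ↦ (L_2 u, - L_1 u)`. -/
theorem isCurlProj_two (ζ η : Hvec P 2) :
    IsCurlProj ζ η ↔ ∃ (u : H0 P) (Du : Hvec P 2) (Dη Dζ : Fin 2 → Hvec P 2),
      MemH2 2 u ∧ IsGrad u Du ∧ η 0 = Du 1 ∧ η 1 = - Du 0 ∧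
      IsJacobian η Dη ∧ IsJacobian ζ Dζ ∧ Dη 1 0 - Dη 0 1 = Dζ 1 0 - Dζ 0 1 := by
  constructor
  · rintro ⟨v, Dv, Dη, Dζ, hanti, hH2, hgrad, hη, hJη, hJζ, hc⟩
    have hself : ∀ i, Dv i i = 0 := fun i => by
      have h2 : (2 : ℂ) • v i i = 0 := by
        rw [two_smul]
        exact eq_neg_iff_add_eq_zero.1 (hanti i i)
      have h0 : v i i = 0 := (smul_eq_zero.1 h2).resolve_left two_ne_zero
      have h1 := hgrad i i
      rw [h0] at h1
      exact h1.unique IsGrad.zero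
    have hD : ∀ i j, Dv i j = - Dv j i := fun i j => by
      have h1 := (hgrad j i).neg
      rw [← hanti i j] at h1
      exact (hgrad i j).unique h1
    refine ⟨v 0 1, Dv 0 1, Dη, Dζ, hH2 0 1, hgrad 0 1, ?_, ?_, hJη, hJζ, hc 0 1⟩
    · rw [hη 0, Fin.sum_univ_two]
      simp [hself, hD 1 0]
    · rw [hη 1, Fin.sum_univ_two]
      simp [hself]
  · rintro ⟨u, Du, Dη, Dζ, hH2, hg, h0, h1, hJη, hJζ, hc⟩
    refine ⟨![![0, u], ![-u, 0]], ![![0, Du], ![-Du, 0]], Dη, Dζ, ?_, ?_, ?_, ?_, hJη, hJζ, ?_⟩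
    · intro i j
      fin_cases i <;> fin_cases j <;> simp
    · intro i j
      fin_cases i <;> fin_cases j
      exacts [MemH2.zero, hH2, hH2.neg, MemH2.zero]
    · intro i j
      fin_cases i <;> fin_cases j
      exacts [IsGrad.zero, hg, hg.neg, IsGrad.zero]
    · intro j
      rw [Fin.sum_univ_two]
      fin_cases j
      · simp [h0]
      · simp [h1]
    · intro i j
      fin_cases i <;> fin_cases j
      · simp
      · exact hc
      · rw [← neg_sub, ← neg_sub (Dζ _ _)]; exact congrArg Neg.neg hc
      · simp

end Two

end Curl

end

end Polycrystal

open MeasureTheory Filter Topology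
open scoped ENNReal

namespace Polycrystal

noncomputable section

/-! ### The projections of a representation of `C(X, ℝ)` -/

section SpectralMeasure

set_option linter.unusedSectionVars false

variable {X : Type*} [MetricSpace X] [CompactSpace X] [MeasurableSpace X] [BorelSpace X]
  {H : Type*} [NormedAddCommGroup H] [InnerProductSpace ℂ H] [CompleteSpace H]
  (Φ : C(X, ℝ) →⋆ₐ[ℝ] (H →L[ℂ] H))

/-! The problem reduces to one question in a Hilbert space: a closed subspace `K` with orthogonal
projection Γ, a projection `X`, and a medium b(1 - (1 - h)X) with h = a/b. For E = E₀ + F with E₀ ⟂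
K and F ∈ K, the weak equation says F = (1 - h)ΓXE. Applying X gives (1 - (1 - h)XΓX)XE = XE₀. Since
XΓX has spectrum in [0,1] (`spectrum_compression_subset`), this is uniquely solvable for every h off
(-∞,0] (`isUnit_of_mem_slitPlane`, `eq_solution_iff`). Constants are orthogonal to K, so the mean of
the flux is δ - (1 - h)⟨(1 - (1 - h)XΓX)⁻¹Xe_j · e_k⟩, which is the resolvent formula at s = 1/(1 -
h). Positivity follows from the energy identity, in which the imaginary part is Im h · ‖XE‖²
(`im_inner_solution_nonneg`). All four functions are the single function `effective`, for two
choices of K and two of X.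

Identifying Γ and Υ with projections rests on the Helmholtz decomposition. Its core is
`eq_zero_of_isCurlFree_of_isDivFree`: a curl-free, divergence-free field of mean zero vanishes.
After mollification its derivatives exist, their norms vanish by integration by parts, and
ergodicity makes the field constant. Hence gradients are dense in the curl-free fields of mean zero
and rotations in the divergence-free ones, and `setOf_eq_closure` turns this density into the graph
closures that define Γ and Υ.

The spectral measure is built from the continuous functional calculus: the Riesz–Markov measure of ψ
makes f ↦ Φ f ψ an isometry on continuous functions in L², and extending it to indicators gives
Q(B)ψ. The off-diagonal measures are real because complex conjugation commutes with X and Γ and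
fixes the e_j (`inner_symm_of_conj`); polarization then needs only two positive measures. -/

theorem repr_isSelfAdjoint (f : C(X, ℝ)) : IsSelfAdjoint (Φ f) :=
  (IsSelfAdjoint.all f).map Φ

theorem repr_inner_left (f : C(X, ℝ)) (ψ φ : H) :
    inner ℂ (Φ f ψ) φ = inner ℂ ψ (Φ f φ) :=
  (ContinuousLinearMap.isSelfAdjoint_iff_isSymmetric.1 (repr_isSelfAdjoint Φ f)) ψ φ

theorem repr_inner_mul (f g : C(X, ℝ)) (ψ φ : H) :
    inner ℂ (Φ f ψ) (Φ g φ) = inner ℂ ψ (Φ (f * g) φ) := by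
  rw [repr_inner_left, map_mul]; rfl

theorem repr_inner_self_im (f : C(X, ℝ)) (ψ : H) : (inner ℂ ψ (Φ f ψ)).im = 0 := by
  have h := repr_inner_left Φ f ψ ψ
  rw [← inner_conj_symm] at h
  exact Complex.conj_eq_iff_im.1 h

/-- With g = √f the quadratic form equals ‖Φ g ψ‖². -/
theorem repr_inner_self_nonneg {f : C(X, ℝ)} (hf : 0 ≤ f) (ψ : H) :
    0 ≤ (inner ℂ ψ (Φ f ψ)).re := by
  let g : C(X, ℝ) := ⟨fun x => √(f x), by fun_prop⟩
  have hg : g * g = f := by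
    ext x
    exact Real.mul_self_sqrt (hf x)
  rw [← hg, ← repr_inner_mul, inner_self_eq_norm_sq_to_K]
  rw [← RCLike.ofReal_pow]
  exact sq_nonneg ‖Φ g ψ‖

/-- The positive functional `f ↦ ⟨ψ, Φ f ψ⟩`. -/
def scalarFunctional (ψ : H) : CompactlySupportedContinuousMap X ℝ →ₚ[ℝ] ℝ :=
  PositiveLinearMap.mk₀
    { toFun := fun f => (inner ℂ ψ (Φ (f : C(X, ℝ)) ψ)).re
      map_add' := fun f g => by
        have : ((f + g : CompactlySupportedContinuousMap X ℝ) : C(X, ℝ)) = (f : C(X, ℝ)) + g := rfl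
        rw [this, map_add, add_apply, inner_add_right, Complex.add_re]
      map_smul' := fun c f => by
        have : ((c • f : CompactlySupportedContinuousMap X ℝ) : C(X, ℝ)) = c • (f : C(X, ℝ)) := rfl
        rw [this, map_smul, smul_apply, inner_smul_right_eq_smul,
          Complex.smul_re, RingHom.id_apply] }
    fun f hf => repr_inner_self_nonneg Φ (f := (f : C(X, ℝ))) hf ψ

/-- The measure `ν` with `∫ f dν = ⟨ψ, Φ f ψ⟩`. -/
def scalarMeasure (ψ : H) : Measure X := RealRMK.rieszMeasure (scalarFunctional Φ ψ)

instance (ψ : H) : IsFiniteMeasure (scalarMeasure Φ ψ) := by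
  have : (scalarMeasure Φ ψ).Regular := RealRMK.regular_rieszMeasure _
  infer_instance

theorem integral_scalarMeasure (f : C(X, ℝ)) (ψ : H) :
    ∫ x, f x ∂scalarMeasure Φ ψ = (inner ℂ ψ (Φ f ψ)).re :=
  RealRMK.integral_rieszMeasure (scalarFunctional Φ ψ)
    (CompactlySupportedContinuousMap.continuousMapEquiv f)

theorem ofReal_integral_scalarMeasure (f : C(X, ℝ)) (ψ : H) :
    ((∫ x, f x ∂scalarMeasure Φ ψ : ℝ) : ℂ) = inner ℂ ψ (Φ f ψ) := by
  rw [integral_scalarMeasure]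
  exact Complex.ext rfl (repr_inner_self_im Φ f ψ).symm

/-- The class of a continuous function in `L²` of the scalar measure. -/
abbrev toL2 (ψ : H) : C(X, ℝ) →L[ℝ] Lp ℝ 2 (scalarMeasure Φ ψ) :=
  ContinuousMap.toLp 2 (scalarMeasure Φ ψ) ℝ

/-- Both squares equal the integral of f² against the scalar measure, because Φ is multiplicative.
This isometry is what lets the orbit map extend to all of L². -/
theorem norm_toL2 (ψ : H) (f : C(X, ℝ)) : ‖toL2 Φ ψ f‖ = ‖Φ f ψ‖ := by
  have h1 : ‖toL2 Φ ψ f‖ ^ 2 = ‖Φ f ψ‖ ^ 2 := by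
    rw [← real_inner_self_eq_norm_sq, L2.inner_def,
      show ‖Φ f ψ‖ ^ 2 = (inner ℂ (Φ f ψ) (Φ f ψ)).re from (inner_self_eq_norm_sq (𝕜 := ℂ) _).symm,
      repr_inner_mul, ← integral_scalarMeasure]
    refine integral_congr_ae ?_
    filter_upwards [ContinuousMap.coeFn_toLp (p := 2) (𝕜 := ℝ) (scalarMeasure Φ ψ) f] with x hx
    rw [hx]
    rfl
  exact (sq_eq_sq₀ (norm_nonneg _) (norm_nonneg _)).1 h1

/-- The map `f ↦ Φ f ψ`. -/
def orbitMap (ψ : H) : C(X, ℝ) →ₗ[ℝ] H where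
  toFun f := Φ f ψ
  map_add' f g := by rw [map_add]; rfl
  map_smul' c f := by rw [map_smul]; rfl

/-- The isometry `L²(ν_ψ) → H` extending `f ↦ Φ f ψ`. -/
def cyclicMap (ψ : H) : Lp ℝ 2 (scalarMeasure Φ ψ) →L[ℝ] H :=
  (orbitMap Φ ψ).extendOfNorm (toL2 Φ ψ).toLinearMap

theorem denseRange_toL2 (ψ : H) : DenseRange (toL2 Φ ψ) :=
  ContinuousMap.toLp_denseRange ℝ (scalarMeasure Φ ψ) ℝ (by simp)

theorem cyclicMap_toL2 (ψ : H) (f : C(X, ℝ)) : cyclicMap Φ ψ (toL2 Φ ψ f) = Φ f ψ :=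
  LinearMap.extendOfNorm_eq (f := orbitMap Φ ψ) (e := (toL2 Φ ψ).toLinearMap) (denseRange_toL2 Φ ψ)
    ⟨1, fun f => by rw [one_mul]; exact (norm_toL2 Φ ψ f).ge⟩ f

theorem norm_cyclicMap (ψ : H) (F : Lp ℝ 2 (scalarMeasure Φ ψ)) : ‖cyclicMap Φ ψ F‖ = ‖F‖ := by
  refine (denseRange_toL2 Φ ψ).induction_on (p := fun F => ‖cyclicMap Φ ψ F‖ = ‖F‖) F
    (isClosed_eq (by fun_prop) (by fun_prop)) fun f => ?_
  rw [cyclicMap_toL2, norm_toL2]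

variable {B : Set X} (hB : MeasurableSet B)

/-- The vector `Q(B) ψ`. -/
def projVec (ψ : H) : H :=
  cyclicMap Φ ψ (indicatorConstLp 2 hB (measure_ne_top _ _) 1)

theorem norm_repr_sub_projVec (g : C(X, ℝ)) (ψ : H) :
    ‖Φ g ψ - projVec Φ hB ψ‖ =
      (eLpNorm (⇑g - B.indicator fun _ => (1 : ℝ)) 2 (scalarMeasure Φ ψ)).toReal := by
  rw [projVec, ← cyclicMap_toL2, ← map_sub, norm_cyclicMap, Lp.norm_def]
  congr 1
  refine eLpNorm_congr_ae ((Lp.coeFn_sub _ _).trans ?_)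
  filter_upwards [ContinuousMap.coeFn_toLp (p := 2) (𝕜 := ℝ) (scalarMeasure Φ ψ) g,
    indicatorConstLp_coeFn (p := 2) (μ := scalarMeasure Φ ψ) (hs := hB)
      (hμs := measure_ne_top _ _) (c := (1 : ℝ))] with x h1 h2
  rw [Pi.sub_apply, Pi.sub_apply, h1, h2]

/-- Each vector has its own L² space, so relations between different vectors need one common
approximating sequence. Approximating the indicator in L² of the sum of the scalar measures, which
dominates each of them, provides it; algebraic identities of Φ then pass to the limit. -/
theorem exists_tendsto_projVec {ι : Type*} [Fintype ι] (ψ : ι → H) :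
    ∃ g : ℕ → C(X, ℝ), ∀ i, Tendsto (fun n => Φ (g n) (ψ i)) atTop (𝓝 (projVec Φ hB (ψ i))) := by
  set N : Measure X := ∑ i, scalarMeasure Φ (ψ i) with hN
  have hle : ∀ i, scalarMeasure Φ (ψ i) ≤ N := fun i =>
    Finset.single_le_sum (f := fun i => scalarMeasure Φ (ψ i)) (fun _ _ => Measure.zero_le _)
      (Finset.mem_univ i)
  have hex : ∀ n : ℕ, ∃ g : C(X, ℝ),
      eLpNorm (⇑g - B.indicator fun _ => (1 : ℝ)) 2 N ≤ ENNReal.ofReal (1 / ((n : ℝ) + 1)) := by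
    intro n
    have hmem : MemLp (B.indicator fun _ => (1 : ℝ)) 2 N :=
      memLp_indicator_const 2 hB 1 (Or.inr (measure_ne_top _ _))
    obtain ⟨g, hg, -⟩ := hmem.exists_boundedContinuous_eLpNorm_sub_le (by simp)
      (ε := ENNReal.ofReal (1 / ((n : ℝ) + 1))) (by simp; positivity)
    refine ⟨g.toContinuousMap, ?_⟩
    rw [eLpNorm_sub_comm]
    exact hg
  choose g hg using hex
  refine ⟨g, fun i => tendsto_iff_norm_sub_tendsto_zero.2 ?_⟩
  refine squeeze_zero (fun _ => norm_nonneg _) (fun n => ?_) tendsto_one_div_add_atTop_nhds_zero_nat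
  rw [norm_repr_sub_projVec]
  refine ENNReal.toReal_le_of_le_ofReal (by positivity) ?_
  exact (eLpNorm_mono_measure _ (hle i)).trans (hg n)

theorem norm_projVec_sq (ψ : H) : ‖projVec Φ hB ψ‖ ^ 2 = (scalarMeasure Φ ψ).real B := by
  rw [projVec, norm_cyclicMap, norm_indicatorConstLp (by simp) (by simp)]
  rw [norm_one, one_mul, ← Real.rpow_natCast, ← Real.rpow_mul measureReal_nonneg]
  norm_num

theorem scalarMeasure_real_univ (ψ : H) : (scalarMeasure Φ ψ).real Set.univ = ‖ψ‖ ^ 2 := by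
  have h := integral_scalarMeasure Φ 1 ψ
  rw [map_one] at h
  simpa [← Complex.ofReal_pow] using h

theorem projVec_add (ψ φ : H) :
    projVec Φ hB (ψ + φ) = projVec Φ hB ψ + projVec Φ hB φ := by
  obtain ⟨g, hg⟩ := exists_tendsto_projVec Φ hB ![ψ, φ, ψ + φ]
  refine tendsto_nhds_unique (hg 2) ?_
  simpa using (hg 0).add (hg 1)

/-- No linearity of `Y` is needed, so this covers complex scalars, commuting operators and
antilinear conjugations alike. -/
theorem projVec_map {Y : H → H} (hY : Continuous Y) (hc : ∀ f ψ, Y (Φ f ψ) = Φ f (Y ψ)) (ψ : H) :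
    projVec Φ hB (Y ψ) = Y (projVec Φ hB ψ) := by
  obtain ⟨g, hg⟩ := exists_tendsto_projVec Φ hB ![ψ, Y ψ]
  refine tendsto_nhds_unique (hg 1) ?_
  simpa [Function.comp_def, hc] using (hY.tendsto _).comp (hg 0)

/-- The projection `Q(B)`. -/
def specProj : H →L[ℂ] H :=
  LinearMap.mkContinuous
    { toFun := projVec Φ hB
      map_add' := projVec_add Φ hB
      map_smul' := fun c ψ => projVec_map Φ hB (Y := fun ψ => c • ψ) (by fun_prop)
        (fun f ψ => (map_smul (Φ f) c ψ).symm) ψ } 1 fun ψ => by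
    rw [one_mul]
    refine (sq_le_sq₀ (norm_nonneg _) (norm_nonneg _)).1 ?_
    rw [← scalarMeasure_real_univ Φ ψ]
    exact (norm_projVec_sq Φ hB ψ).trans_le (measureReal_mono (Set.subset_univ _))

theorem specProj_apply (ψ : H) : specProj Φ hB ψ = projVec Φ hB ψ := rfl

theorem projVec_univ (ψ : H) : projVec Φ MeasurableSet.univ ψ = ψ := by
  have h := norm_repr_sub_projVec Φ MeasurableSet.univ 1 ψ
  rw [map_one, Set.indicator_univ] at h
  have h0 : (⇑(1 : C(X, ℝ)) - fun _ => (1 : ℝ)) = 0 := by ext; simp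
  rw [h0, eLpNorm_zero, ENNReal.toReal_zero, norm_eq_zero, sub_eq_zero] at h
  exact h.symm

theorem projVec_union {B' : Set X} (hB' : MeasurableSet B') (hd : Disjoint B B') (ψ : H) :
    projVec Φ (hB.union hB') ψ = projVec Φ hB ψ + projVec Φ hB' ψ := by
  rw [projVec, indicatorConstLp_disjoint_union hB hB' (measure_ne_top _ _) (measure_ne_top _ _) hd,
    map_add]
  rfl

theorem projVec_congr {B' : Set X} (hB' : MeasurableSet B') (h : B = B') (ψ : H) :
    projVec Φ hB ψ = projVec Φ hB' ψ := by
  subst h; rfl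

theorem projVec_compl (ψ : H) : projVec Φ hB.compl ψ = ψ - projVec Φ hB ψ := by
  rw [eq_sub_iff_add_eq', ← projVec_union Φ hB hB.compl disjoint_compl_right,
    projVec_congr Φ _ MeasurableSet.univ (Set.union_compl_self B), projVec_univ]

theorem inner_projVec_left (ψ φ : H) :
    inner ℂ (projVec Φ hB ψ) φ = inner ℂ ψ (projVec Φ hB φ) := by
  obtain ⟨g, hg⟩ := exists_tendsto_projVec Φ hB ![ψ, φ]
  have h1 := (hg 0).inner (𝕜 := ℂ) (tendsto_const_nhds (x := φ))
  have h2 := (tendsto_const_nhds (x := ψ)).inner (𝕜 := ℂ) (hg 1)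
  refine tendsto_nhds_unique h1 (h2.congr fun n => ?_)
  exact (repr_inner_left Φ (g n) ψ φ).symm

/-- Idempotence is not yet available, so the value is read off from the expansion of ‖ψ - Q(B)ψ‖²,
whose left side is the measure of the complement. -/
theorem inner_projVec_self (ψ : H) :
    inner ℂ ψ (projVec Φ hB ψ) = (((scalarMeasure Φ ψ).real B : ℝ) : ℂ) := by
  have h1 := norm_sub_sq (𝕜 := ℂ) ψ (projVec Φ hB ψ)
  rw [← projVec_compl, norm_projVec_sq, norm_projVec_sq, ← scalarMeasure_real_univ Φ ψ,
    measureReal_compl hB] at h1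
  have h2 := inner_projVec_left Φ hB ψ ψ
  rw [← inner_conj_symm] at h2
  refine Complex.ext ?_ (Complex.conj_eq_iff_im.1 h2)
  rw [Complex.ofReal_re]
  change _ = _ - 2 * (inner ℂ ψ (projVec Φ hB ψ)).re + _ at h1
  linarith

theorem isStarProjection_specProj : IsStarProjection (specProj Φ hB) := by
  have hsa : IsSelfAdjoint (specProj Φ hB) :=
    ContinuousLinearMap.isSelfAdjoint_iff_isSymmetric.2 fun ψ φ => inner_projVec_left Φ hB ψ φ
  refine ⟨?_, hsa⟩
  have h : specProj Φ hB * specProj Φ hB - specProj Φ hB = 0 := by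
    rw [← ContinuousLinearMap.coe_inj]
    -- Over ℂ an operator with vanishing quadratic form is zero. Here ⟨Q²ψ, ψ⟩ = ‖Qψ‖² and ⟨Qψ, ψ⟩
    -- are both the measure of B.
    refine (inner_map_self_eq_zero _).1 fun ψ => ?_
    change inner ℂ (projVec Φ hB (projVec Φ hB ψ) - projVec Φ hB ψ) ψ = 0
    rw [inner_sub_left, inner_projVec_left, inner_self_eq_norm_sq_to_K, ← inner_conj_symm,
      inner_projVec_self, Complex.conj_ofReal, ← norm_projVec_sq Φ hB]
    simp
  exact sub_eq_zero.1 h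

/-- A partial sum is the projection of a finite union, and its distance to the limit is the square
root of the measure left over, so countable additivity of the scalar measure suffices. -/
theorem hasSum_projVec {B : ℕ → Set X} (hB : ∀ n, MeasurableSet (B n))
    (hd : Pairwise (Function.onFun Disjoint B)) (ψ : H) :
    HasSum (fun n => projVec Φ (hB n) ψ) (projVec Φ (MeasurableSet.iUnion hB) ψ) := by
  have hfin : ∀ s : Finset ℕ, ∑ n ∈ s, projVec Φ (hB n) ψ =
      projVec Φ (Finset.measurableSet_biUnion s fun n _ => hB n) ψ := by
    intro s
    induction s using Finset.induction_on with
    | empty =>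
      rw [Finset.sum_empty, eq_comm, ← norm_eq_zero, ← sq_eq_zero_iff, norm_projVec_sq]
      simp
    | insert a s ha ih =>
      rw [Finset.sum_insert ha, ih, ← projVec_union Φ (hB a)]
      · exact projVec_congr Φ _ _ (Finset.set_biUnion_insert a s B).symm ψ
      · rw [Set.disjoint_iUnion₂_right]
        intro i hi
        exact hd (fun h => ha (h ▸ hi))
  have hsum : HasSum (fun n => (scalarMeasure Φ ψ).real (B n))
      ((scalarMeasure Φ ψ).real (⋃ n, B n)) := by
    rw [measureReal_def, measure_iUnion hd hB, ENNReal.tsum_toReal_eq fun n => measure_ne_top _ _]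
    refine (ENNReal.summable_toReal ?_).hasSum
    rw [← measure_iUnion hd hB]
    exact measure_ne_top _ _
  refine tendsto_iff_norm_sub_tendsto_zero.2 ?_
  have hnorm : ∀ s : Finset ℕ,
      ‖∑ n ∈ s, projVec Φ (hB n) ψ - projVec Φ (MeasurableSet.iUnion hB) ψ‖ =
        √((scalarMeasure Φ ψ).real (⋃ n, B n) - ∑ n ∈ s, (scalarMeasure Φ ψ).real (B n)) := by
    intro s
    have hs : MeasurableSet (⋃ n ∈ s, B n) := Finset.measurableSet_biUnion s fun n _ => hB n
    have hsub : (⋃ n ∈ s, B n) ⊆ ⋃ n, B n := Set.iUnion₂_subset fun n _ => Set.subset_iUnion B n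
    have hU := MeasurableSet.iUnion hB
    rw [hfin, norm_sub_rev, ← Real.sqrt_sq (norm_nonneg (_ - _))]
    congr 1
    have h1 := projVec_union Φ hs (hU.diff hs) Set.disjoint_sdiff_right ψ
    rw [projVec_congr Φ (hs.union (hU.diff hs)) hU (Set.union_sdiff_cancel hsub)] at h1
    rw [h1, add_sub_cancel_left, norm_projVec_sq, measureReal_sdiff hsub hs,
      measureReal_biUnion_finset (fun m _ n _ h => hd h) fun n _ => hB n]
  simp_rw [hnorm]
  have h0 := (hsum.const_sub ((scalarMeasure Φ ψ).real (⋃ n, B n))).sqrt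
  simpa using h0

end SpectralMeasure

/-! ### The spectral measure of a self-adjoint operator -/

section SpectralTheorem

variable {H : Type*} [NormedAddCommGroup H] [InnerProductSpace ℂ H] [CompleteSpace H]
  {T : H →L[ℂ] H} (hT : IsSelfAdjoint T)

/-- The real continuous functional calculus of `T`. -/
abbrev funCalc : C(spectrum ℝ T, ℝ) →⋆ₐ[ℝ] (H →L[ℂ] H) := cfcHom hT

open Classical in
/-- The spectral measure of `T`. -/
def specMeasure (A : Set ℝ) : H →L[ℂ] H :=
  if hA : MeasurableSet A then specProj (funCalc hT) (measurable_subtype_coe hA) else 0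

theorem specMeasure_apply {A : Set ℝ} (hA : MeasurableSet A) (ψ : H) :
    specMeasure hT A ψ = projVec (funCalc hT) (measurable_subtype_coe hA) ψ := by
  rw [specMeasure, dif_pos hA, specProj_apply]

/-- The measure `A ↦ ⟨ψ, Q(A) ψ⟩`. -/
def vecMeasure (ψ : H) : Measure ℝ := (scalarMeasure (funCalc hT) ψ).map Subtype.val

instance (ψ : H) : IsFiniteMeasure (vecMeasure hT ψ) := by
  unfold vecMeasure
  infer_instance

theorem vecMeasure_real {A : Set ℝ} (hA : MeasurableSet A) (ψ : H) :
    (((vecMeasure hT ψ).real A : ℝ) : ℂ) = inner ℂ ψ (specMeasure hT A ψ) := by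
  rw [specMeasure_apply hT hA, inner_projVec_self, vecMeasure,
    map_measureReal_apply measurable_subtype_coe hA]

theorem isStarProjection_specMeasure {A : Set ℝ} (hA : MeasurableSet A) :
    IsStarProjection (specMeasure hT A) := by
  rw [specMeasure, dif_pos hA]
  exact isStarProjection_specProj _ _

theorem specMeasure_eq_one {A : Set ℝ} (hA : MeasurableSet A) (h : spectrum ℝ T ⊆ A) :
    specMeasure hT A = 1 := by
  ext1 ψ
  rw [specMeasure_apply hT hA, projVec_congr _ _ MeasurableSet.univ, projVec_univ]
  · rfl
  · exact Set.eq_univ_of_forall fun x => h x.2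

theorem isSpectralMeasure_specMeasure : IsSpectralMeasure T (specMeasure hT) where
  isStarProjection _ hA := isStarProjection_specMeasure hT hA
  univ := specMeasure_eq_one hT MeasurableSet.univ (Set.subset_univ _)
  iUnion A hA hd ψ := by
    rw [specMeasure_apply hT (MeasurableSet.iUnion hA), projVec_congr _ _
      (MeasurableSet.iUnion fun n => measurable_subtype_coe (hA n)) Set.preimage_iUnion]
    simp_rw [specMeasure_apply hT (hA _)]
    exact hasSum_projVec _ _ (fun m n h => (hd h).preimage _) ψ
  integral ψ := by
    refine ⟨vecMeasure hT ψ, inferInstance, fun A hA => vecMeasure_real hT hA ψ, ?_, ?_⟩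
    · rw [vecMeasure, (MeasurableEmbedding.subtype_coe
        (spectrum.isClosed (𝕜 := ℝ) T).measurableSet).integrable_map_iff]
      exact (Complex.continuous_ofReal.comp
        continuous_subtype_val).integrable_of_hasCompactSupport (HasCompactSupport.of_compactSpace _)
    · rw [vecMeasure, (MeasurableEmbedding.subtype_coe
        (spectrum.isClosed (𝕜 := ℝ) T).measurableSet).integral_map]
      conv_lhs => rw [← cfcHom_id hT (R := ℝ)]
      refine Eq.trans ?_ integral_ofReal.symm
      exact (ofReal_integral_scalarMeasure (funCalc hT)
        (ContinuousMap.restrict (spectrum ℝ T) (ContinuousMap.id ℝ)) ψ).symm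

/-- A continuous additive map is real-linear, and that is enough because the functions are
real-valued. The statement therefore applies to linear operators and to complex conjugation. The
proof is by density of polynomials on the compact spectrum. -/
theorem funCalc_commute {Y : H →+ H} (hYc : Continuous Y) (hY : ∀ ψ, Y (T ψ) = T (Y ψ)) (f : C(spectrum ℝ T, ℝ))
    (ψ : H) : Y (funCalc hT f ψ) = funCalc hT f (Y ψ) := by
  have hid : ∀ ψ, Y (funCalc hT (ContinuousMap.restrict (spectrum ℝ T) (ContinuousMap.id ℝ)) ψ) =
      funCalc hT (ContinuousMap.restrict (spectrum ℝ T) (ContinuousMap.id ℝ)) (Y ψ) := by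
    rw [funCalc, cfcHom_id hT (R := ℝ)]
    exact hY
  revert ψ
  induction f using ContinuousMap.induction_on_of_compact with
  | const r =>
    intro ψ
    have h : ContinuousMap.const (spectrum ℝ T) r = algebraMap ℝ C(spectrum ℝ T, ℝ) r := rfl
    rw [h, AlgHomClass.commutes, Algebra.algebraMap_eq_smul_one]
    simp only [smul_apply, one_apply_eq_self]
    exact map_real_smul Y hYc r ψ
  | id => exact hid
  | star_id => exact hid
  | add f g hf hg =>
    intro ψ
    rw [map_add, add_apply, map_add, hf, hg, add_apply]
  | mul f g hf hg =>
    intro ψ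
    rw [map_mul, mul_apply_eq_comp, mul_apply_eq_comp, hf, hg]
  | frequently f h =>
    intro ψ
    have hcl : IsClosed {g : C(spectrum ℝ T, ℝ) | Y (funCalc hT g ψ) = funCalc hT g (Y ψ)} := by
      have hc : Continuous (funCalc hT) := cfcHom_continuous hT
      exact isClosed_eq (hYc.comp (hc.clm_apply continuous_const))
        (hc.clm_apply continuous_const)
    exact hcl.mem_of_frequently_of_tendsto (h.mono fun g hg => hg ψ) tendsto_id

theorem specMeasure_commute {Y : H →+ H} (hYc : Continuous Y) (hY : ∀ ψ, Y (T ψ) = T (Y ψ)) {A : Set ℝ}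
    (hA : MeasurableSet A) (ψ : H) : Y (specMeasure hT A ψ) = specMeasure hT A (Y ψ) := by
  rw [specMeasure_apply hT hA, specMeasure_apply hT hA]
  exact (projVec_map _ _ hYc (funCalc_commute hT hYc hY) ψ).symm

end SpectralTheorem

/-! ### Stieltjes representation of the resolvent -/

section Stieltjes

set_option linter.unusedSectionVars false

variable {H : Type*} [NormedAddCommGroup H] [InnerProductSpace ℂ H] [CompleteSpace H]
  {T : H →L[ℂ] H} (hT : IsSelfAdjoint T)

theorem spectrum_real_subset (hs : spectrum ℂ T ⊆ Complex.ofReal '' Set.Icc 0 1) :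
    spectrum ℝ T ⊆ Set.Icc 0 1 := by
  intro l hl
  obtain ⟨l', hl', h⟩ := hs ((spectrum.algebraMap_mem_iff ℂ).2 hl)
  exact (Complex.ofReal_injective h : l' = l) ▸ hl'

variable {s : ℂ}

theorem sub_ofReal_ne_zero (hsmem : s ∉ Complex.ofReal '' Set.Icc 0 1) {l : ℝ}
    (hl : l ∈ Set.Icc (0 : ℝ) 1) : s - l ≠ 0 := fun h =>
  hsmem ⟨l, hl, (sub_eq_zero.1 h).symm⟩

/-- The function `l ↦ 1 / (s - l)` on the spectrum. -/
def cauchyKernel (T : H →L[ℂ] H) (hs : spectrum ℂ T ⊆ Complex.ofReal '' Set.Icc 0 1)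
    (hsmem : s ∉ Complex.ofReal '' Set.Icc 0 1) : C(spectrum ℝ T, ℂ) where
  toFun l := 1 / (s - (l : ℝ))
  continuous_toFun := by
    refine continuous_const.div (by fun_prop) fun l => ?_
    exact sub_ofReal_ne_zero hsmem (spectrum_real_subset hs l.2)

/-- The real part of a complex continuous function. -/
def rePart {X : Type*} [TopologicalSpace X] (f : C(X, ℂ)) : C(X, ℝ) := ⟨fun x => (f x).re, by fun_prop⟩

/-- The imaginary part of a complex continuous function. -/
def imPart {X : Type*} [TopologicalSpace X] (f : C(X, ℂ)) : C(X, ℝ) := ⟨fun x => (f x).im, by fun_prop⟩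

/-- The real functional calculus takes only real functions, so the Cauchy kernel k is split. The
real and imaginary parts of (s - x)k(x) = 1 give two real identities, whose images under the
calculus recombine to say that the right side inverts s - T. -/
theorem resolvent_eq (hs : spectrum ℂ T ⊆ Complex.ofReal '' Set.Icc 0 1)
    (hsmem : s ∉ Complex.ofReal '' Set.Icc 0 1) : resolvent T s = funCalc hT (rePart (cauchyKernel T hs hsmem)) +
    Complex.I • funCalc hT (imPart (cauchyKernel T hs hsmem)) := by
  set k := cauchyKernel T hs hsmem with hk
  set ι : C(spectrum ℝ T, ℝ) := ContinuousMap.restrict (spectrum ℝ T) (ContinuousMap.id ℝ) with hι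
  have hu : IsUnit (algebraMap ℂ (H →L[ℂ] H) s - T) :=
    spectrum.notMem_iff.1 fun h => hsmem (hs h)
  have hkx : ∀ x : spectrum ℝ T, (s - (x : ℝ)) * k x = 1 := fun x =>
    mul_one_div_cancel (sub_ofReal_ne_zero hsmem (spectrum_real_subset hs x.2))
  have h1 : (algebraMap ℝ C(spectrum ℝ T, ℝ) s.re - ι) * rePart k -
      algebraMap ℝ C(spectrum ℝ T, ℝ) s.im * imPart k = 1 := by
    ext x
    simpa [Complex.mul_re] using! congrArg Complex.re (hkx x)
  have h2 : (algebraMap ℝ C(spectrum ℝ T, ℝ) s.re - ι) * imPart k +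
      algebraMap ℝ C(spectrum ℝ T, ℝ) s.im * rePart k = 0 := by
    ext x
    simpa [Complex.mul_im] using! congrArg Complex.im (hkx x)
  have h1' := congrArg (funCalc hT) h1
  have h2' := congrArg (funCalc hT) h2
  simp only [map_sub, map_add, map_mul, map_one, map_zero, AlgHomClass.commutes, hι,
    funCalc, cfcHom_id hT (R := ℝ)] at h1' h2'
  have hmul : (algebraMap ℂ (H →L[ℂ] H) s - T) *
      (funCalc hT (rePart k) + Complex.I • funCalc hT (imPart k)) = 1 := by
    have hsplit : algebraMap ℂ (H →L[ℂ] H) s =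
        algebraMap ℝ (H →L[ℂ] H) s.re + Complex.I • algebraMap ℝ (H →L[ℂ] H) s.im := by
      ext1 ψ
      simp only [Algebra.algebraMap_eq_smul_one, add_apply, smul_apply, one_apply_eq_self]
      rw [← Complex.coe_smul s.re ψ, ← Complex.coe_smul s.im ψ, smul_smul, ← add_smul]
      conv_lhs => rw [← Complex.re_add_im s, mul_comm]
    rw [hsplit, show algebraMap ℝ (H →L[ℂ] H) s.re + Complex.I • algebraMap ℝ (H →L[ℂ] H) s.im - T =
      (algebraMap ℝ (H →L[ℂ] H) s.re - T) + Complex.I • algebraMap ℝ (H →L[ℂ] H) s.im by abel,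
      add_mul, mul_add, mul_add, smul_mul_smul_comm, Complex.I_mul_I, mul_smul_comm, smul_mul_assoc,
      neg_one_smul]
    rw [← sub_eq_zero] at h1'
    have h3 := congrArg (fun S : H →L[ℂ] H => Complex.I • S) h2'
    simp only [smul_add, smul_zero] at h3
    rw [← sub_eq_zero, ← h1', ← sub_eq_zero, ← h3]
    abel
  calc resolvent T s = Ring.inverse (algebraMap ℂ (H →L[ℂ] H) s - T) *
      ((algebraMap ℂ (H →L[ℂ] H) s - T) *
        (funCalc hT (rePart k) + Complex.I • funCalc hT (imPart k))) := by rw [hmul, mul_one]; rfl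
    _ = _ := by rw [← mul_assoc, Ring.inverse_mul_cancel _ hu, one_mul]

theorem vecMeasure_restrict (hs : spectrum ℂ T ⊆ Complex.ofReal '' Set.Icc 0 1) (ψ : H) :
    (vecMeasure hT ψ).restrict (Set.Icc 0 1) = vecMeasure hT ψ := by
  refine Measure.restrict_eq_self_of_ae_mem ?_
  refine (ae_map_iff (p := fun l => l ∈ Set.Icc (0 : ℝ) 1) measurable_subtype_coe.aemeasurable
    measurableSet_Icc).2 ?_
  exact Eventually.of_forall fun x => spectrum_real_subset hs x.2

theorem integrable_cauchyKernel (hs : spectrum ℂ T ⊆ Complex.ofReal '' Set.Icc 0 1)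
    (hsmem : s ∉ Complex.ofReal '' Set.Icc 0 1) (ψ : H) :
    Integrable (fun l : ℝ => 1 / (s - (l : ℂ))) (vecMeasure hT ψ) := by
  rw [← vecMeasure_restrict hT hs]
  refine ContinuousOn.integrableOn_compact isCompact_Icc ?_
  exact continuousOn_const.div (by fun_prop) fun l hl => sub_ofReal_ne_zero hsmem hl

theorem inner_resolvent_self (hs : spectrum ℂ T ⊆ Complex.ofReal '' Set.Icc 0 1)
    (hsmem : s ∉ Complex.ofReal '' Set.Icc 0 1) (ψ : H) :
    inner ℂ ψ (resolvent T s ψ) = ∫ l, 1 / (s - (l : ℂ)) ∂vecMeasure hT ψ := by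
  rw [resolvent_eq hT hs hsmem, add_apply, smul_apply, inner_add_right, inner_smul_right,
    ← ofReal_integral_scalarMeasure, ← ofReal_integral_scalarMeasure, vecMeasure,
    (MeasurableEmbedding.subtype_coe (spectrum.isClosed (𝕜 := ℝ) T).measurableSet).integral_map]
  have hint : Integrable (fun x => cauchyKernel T hs hsmem x) (scalarMeasure (funCalc hT) ψ) :=
    (cauchyKernel T hs hsmem).continuous.integrable_of_hasCompactSupport
      (HasCompactSupport.of_compactSpace _)
  have h := integral_re_add_im hint
  rw [mul_comm]
  exact h

end Stieltjes

/-! ### Real vectors -/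

section RealStructure

set_option linter.unusedSectionVars false

variable {H : Type*} [NormedAddCommGroup H] [InnerProductSpace ℂ H] [CompleteSpace H]
  {T : H →L[ℂ] H}

/-- Symmetry removes the two imaginary terms of complex polarization. What remains is a real
combination of diagonal values, hence of positive measures. -/
theorem four_mul_inner_of_symm {R : H →L[ℂ] H} {x y : H} (h : inner ℂ x (R y) = inner ℂ y (R x)) :
    4 * inner ℂ x (R y) = inner ℂ (x + y) (R (x + y)) - inner ℂ (x - y) (R (x - y)) := by
  simp only [map_add, map_sub, inner_add_left, inner_add_right, inner_sub_left, inner_sub_right,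
    ← h]
  ring

/-- Here `hC` expresses that C is antiunitary. On vectors fixed by C it gives ⟨x, Ry⟩ = ⟨Ry, x⟩, and
self-adjointness moves R across. -/
theorem inner_symm_of_conj {C : H →+ H}
    (hC : ∀ x y, inner ℂ (C x) (C y) = inner ℂ y x) {R : H →L[ℂ] H} (hR : IsSelfAdjoint R)
    (hCR : ∀ ψ, C (R ψ) = R (C ψ)) {x y : H} (hx : C x = x) (hy : C y = y) :
    inner ℂ x (R y) = inner ℂ y (R x) := by
  have h := hC x (R y)
  rw [hCR, hx, hy] at h
  rw [h]
  exact ContinuousLinearMap.isSelfAdjoint_iff_isSymmetric.1 hR y x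

/-- X commutes with T, hence with its spectral measure and its resolvent. So e_k may be replaced by
X e_k, and the entries become values of a symmetric form on the C-fixed vectors X e_j. Polarization
then reduces everything to the diagonal measures. -/
theorem exists_stieltjes_representation {ι : Type*} (hT : IsSelfAdjoint T)
    (hs : spectrum ℂ T ⊆ Complex.ofReal '' Set.Icc 0 1)
    {X : H →L[ℂ] H} (hX : IsStarProjection X) (hXT : Commute X T) {C : H →+ H}
    (hCc : Continuous C) (hC : ∀ x y, inner ℂ (C x) (C y) = inner ℂ y x) (hCT : ∀ ψ, C (T ψ) = T (C ψ))
    (hCX : ∀ ψ, C (X ψ) = X (C ψ)) {e : ι → H} (he : ∀ j, C (e j) = e j) :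
    ∃ Q : Set ℝ → H →L[ℂ] H, IsSpectralMeasure T Q ∧ Q (Set.Icc 0 1) = 1 ∧
    ∃ μ : ι → ι → SignedMeasure ℝ,
      (∀ j k A, MeasurableSet A →
        ((μ j k A : ℝ) : ℂ) = inner ℂ (e k) (Q A (X (e j)))) ∧
      (∀ k, 0 ≤ μ k k) ∧
      ∀ s : ℂ, s ∉ Complex.ofReal '' Set.Icc 0 1 → ∀ j k,
        inner ℂ (e k) (resolvent T s (X (e j))) =
          ∫ᵛ l in Set.Icc (0 : ℝ) 1, 1 / (s - (l : ℂ)) ∂<•(μ j k) := by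
  have hx : ∀ j, C (X (e j)) = X (e j) := fun j => by rw [hCX, he]
  have hXsym : ∀ x y, inner ℂ (X x) y = inner ℂ x (X y) :=
    ContinuousLinearMap.isSelfAdjoint_iff_isSymmetric.1 hX.isSelfAdjoint
  have hXX : ∀ x, X (X x) = X x := fun x => congrArg (fun S : H →L[ℂ] H => S x) hX.isIdempotentElem
  have hXY : ∀ ψ, (X : H →ₗ[ℂ] H).toAddMonoidHom (T ψ) = T (X ψ) := fun ψ =>
    congrArg (fun S : H →L[ℂ] H => S ψ) hXT
  have hmove : ∀ (R : H →L[ℂ] H), (∀ ψ, X (R ψ) = R (X ψ)) → ∀ j k,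
      inner ℂ (e k) (R (X (e j))) = inner ℂ (X (e k)) (R (X (e j))) := fun R hR j k => by
    rw [hXsym, hR, hXX]
  set μ : ι → ι → SignedMeasure ℝ := fun j k =>
    (4⁻¹ : ℝ) • ((vecMeasure hT (X (e k) + X (e j))).toSignedMeasure -
      (vecMeasure hT (X (e k) - X (e j))).toSignedMeasure) with hμ
  have hval : ∀ j k A, MeasurableSet A →
      ((μ j k A : ℝ) : ℂ) = inner ℂ (X (e k)) (specMeasure hT A (X (e j))) := by
    intro j k A hA
    have h := four_mul_inner_of_symm (inner_symm_of_conj hC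
      (isStarProjection_specMeasure hT hA).isSelfAdjoint
      (fun ψ => specMeasure_commute hT hCc hCT hA ψ) (hx k) (hx j))
    rw [← vecMeasure_real hT hA, ← vecMeasure_real hT hA] at h
    rw [hμ, smul_apply, sub_apply, Measure.toSignedMeasure_apply_measurable hA,
      Measure.toSignedMeasure_apply_measurable hA, smul_eq_mul]
    push_cast
    rw [← h]
    ring
  refine ⟨specMeasure hT, isSpectralMeasure_specMeasure hT,
    specMeasure_eq_one hT measurableSet_Icc (spectrum_real_subset hs), μ, ?_, ?_, ?_⟩
  · intro j k A hA
    rw [hval j k A hA, hmove _ (fun ψ => specMeasure_commute hT X.continuous hXY hA ψ)]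
  · intro k
    rw [VectorMeasure.le_iff]
    intro A hA
    have h := hval k k A hA
    rw [← vecMeasure_real hT hA] at h
    rw [Complex.ofReal_injective h]
    exact measureReal_nonneg
  · intro s hsmem j k
    -- For nonreal s the resolvent is not self-adjoint in general, so symmetry is checked on its two
    -- self-adjoint parts separately.
    have hsym : inner ℂ (X (e k)) (resolvent T s (X (e j))) =
        inner ℂ (X (e j)) (resolvent T s (X (e k))) := by
      rw [resolvent_eq hT hs hsmem]
      simp only [add_apply, smul_apply, inner_add_right, inner_smul_right]
      rw [inner_symm_of_conj hC (repr_isSelfAdjoint _ _) (funCalc_commute hT hCc hCT _) (hx k) (hx j),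
        inner_symm_of_conj hC (repr_isSelfAdjoint _ _) (funCalc_commute hT hCc hCT _) (hx k) (hx j)]
    have hcomm : ∀ ψ, X (resolvent T s ψ) = resolvent T s (X ψ) := fun ψ => by
      have h := fun f => funCalc_commute hT X.continuous hXY f ψ
      simp only [LinearMap.toAddMonoidHom_coe, ContinuousLinearMap.coe_coe] at h
      rw [resolvent_eq hT hs hsmem]
      simp only [add_apply, smul_apply, map_add, map_smul, h]
    have h := four_mul_inner_of_symm hsym
    rw [hmove _ hcomm, VectorMeasure.restrict_smul, VectorMeasure.integral_smul_vectorMeasure,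
      VectorMeasure.restrict_sub, VectorMeasure.restrict_toSignedMeasure measurableSet_Icc,
      VectorMeasure.restrict_toSignedMeasure measurableSet_Icc]
    have hI : ∀ ψ, ((vecMeasure hT ψ).restrict (Set.Icc 0 1)).toSignedMeasure.Integrable
        (fun l : ℝ => 1 / (s - (l : ℂ))) := fun ψ => by
      rw [VectorMeasure.Integrable, Measure.variation_toSignedMeasure, vecMeasure_restrict hT hs]
      exact integrable_cauchyKernel hT hs hsmem ψ
    rw [VectorMeasure.integral_sub_vectorMeasure (hI _) (hI _),
      VectorMeasure.integral_toSignedMeasure, VectorMeasure.integral_toSignedMeasure,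
      vecMeasure_restrict hT hs, vecMeasure_restrict hT hs,
      ← inner_resolvent_self hT hs hsmem, ← inner_resolvent_self hT hs hsmem, ← h,
      Complex.real_smul]
    push_cast
    ring

end RealStructure

/-! ### Compressions of projections -/

/-- Since pqp = (qp)*(qp), it is nonnegative, and its norm is ‖qp‖² ≤ 1. -/
theorem spectrum_compression_subset {A : Type*} [CStarAlgebra A] {p q : A}
    (hp : IsStarProjection p) (hq : IsStarProjection q) :
    spectrum ℂ (p * (q * p)) ⊆ Complex.ofReal '' Set.Icc 0 1 := by
  have ha : p * (q * p) = star (q * p) * (q * p) := by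
    rw [star_mul, hp.isSelfAdjoint.star_eq, hq.isSelfAdjoint.star_eq, mul_assoc, ← mul_assoc q q,
      hq.isIdempotentElem.eq]
  rw [ha]
  intro z hz
  have hre := (IsSelfAdjoint.star_mul_self (q * p)).mem_spectrum_eq_re hz
  refine ⟨z.re, ⟨?_, ?_⟩, hre.symm⟩
  · refine spectrum_star_mul_self_nonneg (b := q * p) z.re ((spectrum.algebraMap_mem_iff ℂ).1 ?_)
    exact hre ▸ hz
  · rcases subsingleton_or_nontrivial A with h | h
    · exact absurd hz (by simp [spectrum.of_subsingleton])
    · have h1 : ‖q * p‖ ≤ 1 := (norm_mul_le _ _).trans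
        (mul_le_one₀ (hq.norm_le _) (norm_nonneg _) (hp.norm_le _))
      calc z.re ≤ ‖z‖ := Complex.re_le_norm z
        _ ≤ ‖star (q * p) * (q * p)‖ := spectrum.norm_le_norm_of_mem hz
        _ = ‖q * p‖ * ‖q * p‖ := CStarRing.norm_star_mul_self
        _ ≤ 1 := mul_le_one₀ h1 (norm_nonneg _) h1

/-! ### Multiplication operators, complex conjugation and constant fields -/

section FieldOperators

set_option linter.unusedSectionVars false

variable {Ω : Type*} [MeasurableSpace Ω] (P : Measure Ω) [IsProbabilityMeasure P] {d : ℕ}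

theorem coeFn_mulOp (f : Ω → ℂ) (hf : MemLp f ∞ P) (ξ : H0 P) :
    mulOp P f hf ξ =ᵐ[P] fun ω => f ω * ξ ω := by
  filter_upwards [(ContinuousLinearMap.mul ℂ ℂ).coeFn_holder (hf.toLp f) ξ (r := 2),
    hf.coeFn_toLp] with ω h1 h2
  change ((ContinuousLinearMap.mul ℂ ℂ).holder 2 (hf.toLp f) ξ) ω = _
  rw [h1, h2]
  rfl

theorem op_apply (R : Orientation Ω d) (v : Fin d → ℝ) (ξ : Hvec P d) (i : Fin d) :
    R.op P v ξ i = ∑ j, mulOp P _ (R.memLp_conj P v i j) (ξ j) := by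
  simp [Orientation.op]

theorem coeFn_sum {ι : Type*} (s : Finset ι) (f : ι → H0 P) :
    (∑ i ∈ s, f i : H0 P) =ᵐ[P] fun ω => ∑ i ∈ s, f i ω := by
  classical
  induction s using Finset.induction_on with
  | empty =>
    simp only [Finset.sum_empty]
    exact Lp.coeFn_zero ℂ 2 P
  | insert a s ha ih =>
    rw [Finset.sum_insert ha]
    filter_upwards [Lp.coeFn_add (f a) (∑ i ∈ s, f i), ih] with ω h1 h2
    rw [h1, Pi.add_apply, h2, Finset.sum_insert ha]

theorem coeFn_op (R : Orientation Ω d) (v : Fin d → ℝ) (ξ : Hvec P d) (i : Fin d) :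
    R.op P v ξ i =ᵐ[P] fun ω => ∑ j, (R.conj v ω i j : ℂ) * ξ j ω := by
  rw [op_apply]
  have h := fun j => coeFn_mulOp P _ (R.memLp_conj P v i j) (ξ j)
  filter_upwards [coeFn_sum P Finset.univ fun j => mulOp P _ (R.memLp_conj P v i j) (ξ j),
    ae_all_iff.2 h] with ω h1 h2
  rw [h1]
  exact Finset.sum_congr rfl fun j _ => h2 j

theorem rot_mul_transpose (R : Orientation Ω d) (ω : Ω) :
    (R.rot ω : Matrix (Fin d) (Fin d) ℝ) * (R.rot ω : Matrix (Fin d) (Fin d) ℝ).transpose = 1 :=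
  Matrix.mem_unitaryGroup_iff.1 (Matrix.mem_specialUnitaryGroup_iff.1 (R.rot ω).2).1

theorem transpose_mul_rot (R : Orientation Ω d) (ω : Ω) :
    (R.rot ω : Matrix (Fin d) (Fin d) ℝ).transpose * (R.rot ω : Matrix (Fin d) (Fin d) ℝ) = 1 :=
  Matrix.mem_unitaryGroup_iff'.1 (Matrix.mem_specialUnitaryGroup_iff.1 (R.rot ω).2).1

theorem conj_mul_conj (R : Orientation Ω d) (v w : Fin d → ℝ) (ω : Ω) :
    R.conj v ω * R.conj w ω = R.conj (v * w) ω := by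
  simp only [Orientation.conj]
  rw [show v * w = fun i => v i * w i from rfl, ← Matrix.diagonal_mul_diagonal]
  calc _ = (R.rot ω : Matrix (Fin d) (Fin d) ℝ).transpose * Matrix.diagonal v *
      ((R.rot ω : Matrix (Fin d) (Fin d) ℝ) * (R.rot ω : Matrix (Fin d) (Fin d) ℝ).transpose) *
      Matrix.diagonal w * R.rot ω := by simp only [Matrix.mul_assoc]
    _ = _ := by rw [rot_mul_transpose, Matrix.mul_one]; simp only [Matrix.mul_assoc]

theorem conj_symm (R : Orientation Ω d) (v : Fin d → ℝ) (ω : Ω) (i j : Fin d) :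
    R.conj v ω i j = R.conj v ω j i := by
  have h : (R.conj v ω).transpose = R.conj v ω := by
    simp [Orientation.conj, Matrix.transpose_mul, Matrix.mul_assoc]
  exact congrFun (congrFun h j) i

theorem op_mul_op (R : Orientation Ω d) (v w : Fin d → ℝ) :
    R.op P v * R.op P w = R.op P (v * w) := by
  refine ContinuousLinearMap.ext fun ξ => PiLp.ext fun i => Lp.ext ?_
  change (R.op P v (R.op P w ξ)) i =ᵐ[P] _
  have h := fun j => coeFn_op P R w ξ j
  filter_upwards [coeFn_op P R v (R.op P w ξ) i, coeFn_op P R (v * w) ξ i, ae_all_iff.2 h]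
    with ω h1 h2 h3
  rw [h1, h2]
  simp only [h3, ← conj_mul_conj, Matrix.mul_apply]
  push_cast
  simp only [Finset.mul_sum, Finset.sum_mul]
  rw [Finset.sum_comm]
  simp only [mul_assoc]

theorem op_add (R : Orientation Ω d) (v w : Fin d → ℝ) :
    R.op P v + R.op P w = R.op P (v + w) := by
  refine ContinuousLinearMap.ext fun ξ => PiLp.ext fun i => Lp.ext ?_
  have h4 : ∀ ω, R.conj (v + w) ω = R.conj v ω + R.conj w ω := fun ω => by
    simp only [Orientation.conj]
    rw [show v + w = fun i => v i + w i from rfl, ← Matrix.diagonal_add, Matrix.mul_add,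
      Matrix.add_mul]
  filter_upwards [Lp.coeFn_add (R.op P v ξ i) (R.op P w ξ i), coeFn_op P R v ξ i,
    coeFn_op P R w ξ i, coeFn_op P R (v + w) ξ i] with ω h0 h1 h2 h3
  rw [h3]
  refine h0.trans ?_
  rw [Pi.add_apply, h1, h2, ← Finset.sum_add_distrib]
  refine Finset.sum_congr rfl fun j _ => ?_
  rw [h4, Matrix.add_apply]
  push_cast
  ring

theorem op_one (R : Orientation Ω d) : R.op P 1 = 1 := by
  refine ContinuousLinearMap.ext fun ξ => PiLp.ext fun i => Lp.ext ?_
  have h4 : ∀ ω, R.conj 1 ω = 1 := fun ω => by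
    simp only [Orientation.conj]
    rw [show (1 : Fin d → ℝ) = fun _ => 1 from rfl, Matrix.diagonal_one, Matrix.mul_one,
      transpose_mul_rot]
  filter_upwards [coeFn_op P R 1 ξ i] with ω h1
  rw [h1]
  simp [h4, Matrix.one_apply, apply_ite Complex.ofReal]

theorem Hvec.inner_def (ξ ζ : Hvec P d) : inner ℂ ξ ζ = ∑ i, inner ℂ (ξ i) (ζ i) := by
  exact PiLp.inner_apply ξ ζ

theorem inner_mulOp {f : Ω → ℂ} (hf : MemLp f ∞ P) (hreal : ∀ ω, (starRingEnd ℂ) (f ω) = f ω)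
    (ξ ζ : H0 P) : inner ℂ (mulOp P f hf ξ) ζ = inner ℂ ξ (mulOp P f hf ζ) := by
  rw [L2.inner_def, L2.inner_def]
  refine integral_congr_ae ?_
  filter_upwards [coeFn_mulOp P f hf ξ, coeFn_mulOp P f hf ζ] with ω h1 h2
  rw [h1, h2, RCLike.inner_apply, RCLike.inner_apply, map_mul, hreal]
  ring

theorem isSelfAdjoint_op (R : Orientation Ω d) (v : Fin d → ℝ) : IsSelfAdjoint (R.op P v) := by
  refine ContinuousLinearMap.isSelfAdjoint_iff_isSymmetric.2 fun ξ ζ => ?_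
  change inner ℂ (R.op P v ξ) ζ = inner ℂ ξ (R.op P v ζ)
  simp only [Hvec.inner_def, op_apply, sum_inner, inner_sum]
  rw [Finset.sum_comm]
  refine Finset.sum_congr rfl fun i _ => Finset.sum_congr rfl fun j _ => ?_
  rw [inner_mulOp P _ fun ω => Complex.conj_ofReal _]
  congr 3
  ext ω
  rw [conj_symm]

variable [NeZero d]

theorem isStarProjection_X1 (R : Orientation Ω d) : IsStarProjection (X1 P R) := by
  refine ⟨?_, isSelfAdjoint_op P R _⟩
  change R.op P _ * R.op P _ = R.op P _
  rw [op_mul_op, ← Pi.single_mul, one_mul]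

theorem X1_add_X2 (R : Orientation Ω d) : X1 P R + X2 P R = 1 := by
  rw [X1, X2, op_add, add_sub_cancel, op_one]

theorem X2_eq (R : Orientation Ω d) : X2 P R = 1 - X1 P R :=
  eq_sub_of_add_eq' (X1_add_X2 P R)

theorem isStarProjection_X2 (R : Orientation Ω d) : IsStarProjection (X2 P R) := by
  rw [X2_eq]
  exact (isStarProjection_X1 P R).one_sub

omit [NeZero d]

/-- Complex conjugation of scalar fields. -/
def conjScalar : H0 P →L[ℝ] H0 P := (Complex.conjCLE : ℂ →L[ℝ] ℂ).compLpL 2 P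

theorem coeFn_conjScalar (f : H0 P) : conjScalar P f =ᵐ[P] fun ω => (starRingEnd ℂ) (f ω) :=
  (Complex.conjCLE : ℂ →L[ℝ] ℂ).coeFn_compLpL f

theorem conjScalar_conjScalar (f : H0 P) : conjScalar P (conjScalar P f) = f := by
  refine Lp.ext ?_
  filter_upwards [coeFn_conjScalar P f, coeFn_conjScalar P (conjScalar P f)] with ω h1 h2
  rw [h2, h1, Complex.conj_conj]

theorem inner_conjScalar (f g : H0 P) :
    inner ℂ (conjScalar P f) (conjScalar P g) = inner ℂ g f := by
  rw [L2.inner_def, L2.inner_def]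
  refine integral_congr_ae ?_
  filter_upwards [coeFn_conjScalar P f, coeFn_conjScalar P g] with ω h1 h2
  rw [h1, h2, RCLike.inner_apply, RCLike.inner_apply, Complex.conj_conj, mul_comm]

/-- Complex conjugation of vector fields. -/
def conjField : Hvec P d →+ Hvec P d where
  toFun ξ := WithLp.toLp 2 fun i => conjScalar P (ξ i)
  map_zero' := by ext1 i; simp
  map_add' ξ ζ := by ext1 i; simp

@[simp] theorem conjField_apply (ξ : Hvec P d) (i : Fin d) :
    conjField P ξ i = conjScalar P (ξ i) := rfl

theorem continuous_conjField : Continuous (conjField P : Hvec P d → Hvec P d) := by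
  refine (PiLp.continuous_toLp 2 _).comp (continuous_pi fun i => ?_)
  exact (conjScalar P).continuous.comp (PiLp.continuous_apply 2 _ i)

theorem conjField_conjField (ξ : Hvec P d) : conjField P (conjField P ξ) = ξ := by
  ext1 i
  simp [conjScalar_conjScalar]

theorem inner_conjField (ξ ζ : Hvec P d) :
    inner ℂ (conjField P ξ) (conjField P ζ) = inner ℂ ζ ξ := by
  simp only [Hvec.inner_def, conjField_apply, inner_conjScalar]

theorem conjField_op (R : Orientation Ω d) (v : Fin d → ℝ) (ξ : Hvec P d) :
    conjField P (R.op P v ξ) = R.op P v (conjField P ξ) := by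
  refine PiLp.ext fun i => Lp.ext ?_
  rw [conjField_apply]
  have h := fun j => coeFn_conjScalar P (ξ j)
  filter_upwards [coeFn_conjScalar P (R.op P v ξ i), coeFn_op P R v ξ i,
    coeFn_op P R v (conjField P ξ) i, ae_all_iff.2 h] with ω h1 h2 h3 h4
  rw [h1, h2, h3, map_sum]
  refine Finset.sum_congr rfl fun j _ => ?_
  rw [map_mul, Complex.conj_ofReal, conjField_apply, h4]

theorem conjField_basisField (j : Fin d) : conjField P (basisField P j) = basisField P j := by
  refine PiLp.ext fun i => Lp.ext ?_
  rw [conjField_apply]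
  filter_upwards [coeFn_conjScalar P (basisField P j i),
    Lp.coeFn_const 2 P ((Pi.single j 1 : Fin d → ℂ) i)] with ω h1 h2
  rw [h1]
  change (starRingEnd ℂ) ((Lp.const 2 P ((Pi.single j 1 : Fin d → ℂ) i)) ω) =
    (Lp.const 2 P ((Pi.single j 1 : Fin d → ℂ) i)) ω
  rw [h2]
  by_cases h : i = j <;> simp [h]

theorem inner_const_left (c : ℂ) (f : H0 P) :
    inner ℂ (Lp.const 2 P c) f = (starRingEnd ℂ) c * ∫ ω, f ω ∂P := by
  rw [L2.inner_def, ← integral_const_mul]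
  refine integral_congr_ae ?_
  filter_upwards [Lp.coeFn_const 2 P c] with ω h1
  rw [h1, RCLike.inner_apply, Function.const_apply, mul_comm]

theorem inner_constField_left (c : Fin d → ℂ) (ξ : Hvec P d) :
    inner ℂ (constField P c) ξ = ∑ i, (starRingEnd ℂ) (c i) * mean ξ i := by
  rw [Hvec.inner_def]
  exact Finset.sum_congr rfl fun i _ => inner_const_left P _ _

theorem inner_basisField_left (k : Fin d) (ξ : Hvec P d) :
    inner ℂ (basisField P k) ξ = mean ξ k := by
  rw [basisField, inner_constField_left, Finset.sum_eq_single k]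
  · simp
  · intro i _ h
    simp [h]
  · simp

theorem mean_constField (c : Fin d → ℂ) : mean (constField P c) = c := by
  ext i
  change ∫ ω, (Lp.const 2 P (c i)) ω ∂P = c i
  rw [integral_congr_ae (Lp.coeFn_const 2 P (c i))]
  simp

/-- `constField` as a linear map. -/
def constLin : (Fin d → ℂ) →ₗ[ℂ] Hvec P d where
  toFun := constField P
  map_add' a b := by ext1 i; simp [constField]
  map_smul' a b := by ext1 i; exact (Lp.constₗ 2 P ℂ).map_smul a (b i)

theorem constField_eq_sum (c : Fin d → ℂ) : constField P c = ∑ j, c j • basisField P j := by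
  change constLin P c = ∑ j, c j • constLin P (Pi.single j 1)
  conv_lhs => rw [pi_eq_sum_univ' c, map_sum]
  refine Finset.sum_congr rfl fun j _ => ?_
  rw [← map_smul]

end FieldOperators

/-! ### The translation group and its generators -/

section Translation

set_option linter.unusedSectionVars false

variable {Ω : Type*} [MeasurableSpace Ω] {P : Measure Ω} [IsProbabilityMeasure P] {d : ℕ}
  [AddAction (Fin d → ℝ) Ω] [MeasurableConstVAdd (Fin d → ℝ) Ω]
  [VAddInvariantMeasure (Fin d → ℝ) Ω P]

variable (P) in
/-- The unitary operator `T_x`. -/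
def translateIsom (x : Fin d → ℝ) : H0 P →ₗᵢ[ℂ] H0 P :=
  Lp.compMeasurePreservingₗᵢ ℂ (fun ω : Ω => (-x) +ᵥ ω) (measurePreserving_vadd (-x) P)

variable (P) in
/-- The operator `T_x` as a real continuous linear map. -/
def translateCLM (x : Fin d → ℝ) : H0 P →L[ℝ] H0 P :=
  (Lp.compMeasurePreservingₗᵢ ℝ (fun ω : Ω => (-x) +ᵥ ω)
    (measurePreserving_vadd (-x) P)).toContinuousLinearMap

theorem translateCLM_apply (x : Fin d → ℝ) (f : H0 P) : translateCLM P x f = translate P x f :=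
  rfl

theorem coeFn_translate (x : Fin d → ℝ) (f : H0 P) :
    translate P x f =ᵐ[P] fun ω => f ((-x) +ᵥ ω) :=
  Lp.coeFn_compMeasurePreserving f (measurePreserving_vadd (-x) P)

theorem translate_translate (x y : Fin d → ℝ) (f : H0 P) :
    translate P x (translate P y f) = translate P (x + y) f := by
  refine Lp.ext ?_
  filter_upwards [coeFn_translate x (translate P y f), coeFn_translate (x + y) f,
    (measurePreserving_vadd (-x) P).quasiMeasurePreserving.ae (coeFn_translate y f)]
    with ω h1 h2 h3
  rw [h1, h2, h3, vadd_vadd, neg_add_rev]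

theorem translate_zero (f : H0 P) : translate P (0 : Fin d → ℝ) f = f := by
  refine Lp.ext ?_
  filter_upwards [coeFn_translate (0 : Fin d → ℝ) f] with ω h1
  rw [h1, neg_zero, zero_vadd]

theorem inner_translate_translate (x : Fin d → ℝ) (f g : H0 P) :
    inner ℂ (translate P x f) (translate P x g) = inner ℂ f g :=
  (translateIsom P x).inner_map_map f g

theorem inner_translate_left (x : Fin d → ℝ) (f g : H0 P) :
    inner ℂ (translate P x f) g = inner ℂ f (translate P (-x) g) := by
  rw [← inner_translate_translate (-x) (translate P x f) g, translate_translate, neg_add_cancel,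
    translate_zero]

theorem translate_const (x : Fin d → ℝ) (c : ℂ) :
    translate P x (Lp.const 2 P c) = Lp.const 2 P c := rfl

theorem conjScalar_translate (x : Fin d → ℝ) (f : H0 P) :
    conjScalar P (translate P x f) = translate P x (conjScalar P f) := by
  refine Lp.ext ?_
  filter_upwards [coeFn_conjScalar P (translate P x f), coeFn_translate x f,
    coeFn_translate x (conjScalar P f),
    (measurePreserving_vadd (-x) P).quasiMeasurePreserving.ae (coeFn_conjScalar P f)]
    with ω h1 h2 h3 h4
  rw [h1, h2, h3, h4]

theorem integral_eq_inner_const (f : H0 P) : ∫ ω, f ω ∂P = inner ℂ (Lp.const 2 P (1 : ℂ)) f := by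
  rw [inner_const_left, map_one, one_mul]

theorem IsPartial.add {i : Fin d} {f f' g g' : H0 P} (h : IsPartial i f f') (h' : IsPartial i g g') :
    IsPartial i (f + g) (f' + g') := by
  have h1 := HasDerivAt.add h h'
  refine h1.congr_of_eventuallyEq (Eventually.of_forall fun t => ?_)
  exact map_add (translateCLM P _) f g

theorem IsPartial.smul {i : Fin d} {f f' : H0 P} (c : ℂ) (h : IsPartial i f f') :
    IsPartial i (c • f) (c • f') := by
  have h1 := HasDerivAt.const_smul c h
  refine h1.congr_of_eventuallyEq (Eventually.of_forall fun t => ?_)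
  exact map_smul (translateIsom P _) c f

theorem IsPartial.const (i : Fin d) (c : ℂ) : IsPartial i (Lp.const 2 P c) 0 :=
  hasDerivAt_const (0 : ℝ) (Lp.const 2 P c)

theorem IsPartial.map {i : Fin d} {f f' : H0 P} (h : IsPartial i f f') {M : H0 P →L[ℝ] H0 P}
    (hM : ∀ x : Fin d → ℝ, ∀ f, M (translate P x f) = translate P x (M f)) :
    IsPartial i (M f) (M f') := by
  have h1 := M.hasFDerivAt.comp_hasDerivAt (0 : ℝ) h
  refine h1.congr_of_eventuallyEq (Eventually.of_forall fun t => ?_)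
  exact (hM _ _).symm

theorem IsPartial.hasDerivAt {i : Fin d} {f f' : H0 P} (h : IsPartial i f f') (t : ℝ) :
    HasDerivAt (fun t : ℝ => translate P (Pi.single i t : Fin d → ℝ) f)
      (translate P (Pi.single i t : Fin d → ℝ) f') t := by
  have h1 : HasDerivAt (fun s : ℝ => translate P (Pi.single i s : Fin d → ℝ) f) f' (t - t) := by
    rw [sub_self]
    exact h
  have h2 := (translateCLM P (Pi.single i t : Fin d → ℝ)).hasFDerivAt.comp_hasDerivAt t
    (h1.comp_sub_const t t)
  refine h2.congr_of_eventuallyEq (Eventually.of_forall fun s => ?_)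
  change _ = translate P _ (translate P _ f)
  rw [translate_translate, ← Pi.single_add, add_sub_cancel]

/-- Integration by parts. -/
theorem IsPartial.inner_left {i : Fin d} {f f' g g' : H0 P} (h : IsPartial i f f')
    (h' : IsPartial i g g') : inner ℂ f' g = -inner ℂ f g' := by
  have h1 := HasDerivAt.inner ℂ h h'
  simp only [inner_translate_translate] at h1
  have h2 := h1.unique (hasDerivAt_const _ _)
  rw [Pi.single_zero, translate_zero, translate_zero] at h2
  exact eq_neg_of_add_eq_zero_right h2

theorem IsPartial.integral_eq_zero {i : Fin d} {f f' : H0 P} (h : IsPartial i f f') :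
    ∫ ω, f' ω ∂P = 0 := by
  have h1 := (IsPartial.const (P := P) i 1).inner_left h
  rw [inner_zero_left, zero_eq_neg] at h1
  rw [integral_eq_inner_const, h1]

/-- The difference quotient of `f` in the direction `e_i`. -/
def diffQuot (i : Fin d) (t : ℝ) (f : H0 P) : H0 P :=
  t⁻¹ • (translate P (Pi.single i t : Fin d → ℝ) f - f)

theorem IsPartial.tendsto_diffQuot {i : Fin d} {f f' : H0 P} (h : IsPartial i f f') :
    Tendsto (fun t => diffQuot i t f) (𝓝[≠] 0) (𝓝 f') := by
  have h1 := HasDerivAt.tendsto_slope_zero h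
  simpa [translate_zero, diffQuot] using h1

/-- The translations are unitary and commute, so moving both to the other side of the inner product
exchanges the directions and reverses t. -/
theorem inner_diffQuot (i j : Fin d) (t : ℝ) (f g : H0 P) :
    inner ℂ (diffQuot i t f) (diffQuot j t g) = inner ℂ (diffQuot j (-t) f) (diffQuot i (-t) g) := by
  have hsmul : ∀ (a : ℝ) (u v : H0 P), inner ℂ (a • u) (a • v) = (a * a : ℝ) • inner ℂ u v := by
    intro a u v
    rw [inner_smul_left_eq_smul, inner_smul_right_eq_smul, smul_smul]
  rw [diffQuot, diffQuot, diffQuot, diffQuot, hsmul, hsmul]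
  congr 1
  · ring
  · simp only [inner_sub_left, inner_sub_right, inner_translate_left, translate_translate,
      Pi.single_neg, neg_neg]
    rw [add_comm (-Pi.single i t : Fin d → ℝ)]
    ring

/-- Formally this is two integrations by parts and L_i L_j = L_j L_i. Passing to the limit in
difference quotients avoids any second derivative. It gives curl-free gradients, divergence-free
rotations and the vanishing of harmonic fields. -/
theorem IsPartial.inner_symm {i j : Fin d} {f fi fj g gi gj : H0 P} (hfi : IsPartial i f fi)
    (hfj : IsPartial j f fj) (hgi : IsPartial i g gi) (hgj : IsPartial j g gj) :
    inner ℂ fi gj = inner ℂ fj gi := by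
  have h1 := hfi.tendsto_diffQuot.inner (𝕜 := ℂ) hgj.tendsto_diffQuot
  have h2 := hfj.tendsto_diffQuot.inner (𝕜 := ℂ) hgi.tendsto_diffQuot
  have hneg : Tendsto (fun t : ℝ => -t) (𝓝[≠] 0) (𝓝[≠] 0) := by
    refine tendsto_nhdsWithin_iff.2 ⟨?_, ?_⟩
    · simpa using (continuous_neg.tendsto (0 : ℝ)).mono_left nhdsWithin_le_nhds
    · filter_upwards [self_mem_nhdsWithin] with t ht
      exact neg_ne_zero.2 ht
  refine tendsto_nhds_unique h1 ((h2.comp hneg).congr fun t => ?_)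
  exact (inner_diffQuot i j t f g).symm

/-- By the group law the derivative along each axis vanishes at every t, so f is fixed by axis
translations; these generate ℝ^d, and the stabilizer of f is a subgroup. -/
theorem translate_eq_of_isGrad_zero {f : H0 P} (h : IsGrad f (0 : Hvec P d)) (x : Fin d → ℝ) :
    translate P x f = f := by
  have h1 : ∀ (i : Fin d) (t : ℝ), translate P (Pi.single i t : Fin d → ℝ) f = f := by
    intro i t
    have hd : ∀ s : ℝ, HasDerivAt (fun t : ℝ => translate P (Pi.single i t : Fin d → ℝ) f) 0 s :=
      fun s => by
        have h2 := (h i).hasDerivAt s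
        rwa [show translate P (Pi.single i s : Fin d → ℝ) ((0 : Hvec P d) i) = 0 from
          map_zero (translateCLM P _)] at h2
    have h3 := is_const_of_deriv_eq_zero (fun s => (hd s).differentiableAt) (fun s => (hd s).deriv)
      t 0
    simpa [translate_zero] using h3
  let S : AddSubgroup (Fin d → ℝ) :=
    { carrier := {x | translate P x f = f}
      add_mem' := fun {x y} hx hy => by
        change translate P (x + y) f = f
        rw [← translate_translate, hy, hx]
      zero_mem' := translate_zero f
      neg_mem' := fun {x} hx => by
        change translate P (-x) f = f
        conv_lhs => rw [← show translate P x f = f from hx]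
        rw [translate_translate, neg_add_cancel, translate_zero] }
  change x ∈ S
  rw [← Finset.univ_sum_single x]
  exact S.sum_mem fun i _ => h1 i (x i)

/-! ### Mollification -/

/-- The mollification `∫ φ(t) T_{-t} f dt`. -/
def mollify (φ : ContDiffBump (0 : Fin d → ℝ)) (f : H0 P) : H0 P :=
  ∫ t, φ.normed volume t • translate P (-t) f

section Mollify

variable (hcont : ∀ f : H0 P, Continuous fun x : Fin d → ℝ => translate P x f)
  (φ : ContDiffBump (0 : Fin d → ℝ))

include hcont

theorem integrable_mollify (f : H0 P) :
    Integrable fun t : Fin d → ℝ => φ.normed volume t • translate P (-t) f :=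
  (φ.continuous_normed.smul ((hcont f).comp continuous_neg)).integrable_of_hasCompactSupport
    φ.hasCompactSupport_normed.smul_right

theorem norm_mollify_le (f : H0 P) : ‖mollify φ f‖ ≤ ‖f‖ := by
  refine (norm_integral_le_integral_norm _).trans_eq ?_
  have h : ∀ t : Fin d → ℝ, ‖φ.normed volume t • translate P (-t) f‖ = φ.normed volume t * ‖f‖ := by
    intro t
    rw [norm_smul, Real.norm_of_nonneg (φ.nonneg_normed t)]
    congr 1
    exact (translateIsom P (-t)).norm_map f
  simp_rw [h]
  rw [integral_mul_const, φ.integral_normed, one_mul]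

/-- Mollification as a continuous linear map. -/
def mollifyCLM : H0 P →L[ℝ] H0 P :=
  LinearMap.mkContinuous
    { toFun := mollify φ
      map_add' := fun f g => by
        rw [mollify, mollify, mollify, ← integral_add (integrable_mollify hcont φ f)
          (integrable_mollify hcont φ g)]
        refine integral_congr_ae (Eventually.of_forall fun t => ?_)
        exact (congrArg _ (map_add (translateCLM P (-t)) f g)).trans (smul_add _ _ _)
      map_smul' := fun c f => by
        rw [mollify, mollify, RingHom.id_apply, ← integral_smul]
        refine integral_congr_ae (Eventually.of_forall fun t => ?_)
        exact (congrArg _ (map_smul (translateCLM P (-t)) c f)).trans (smul_comm _ _ _) }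
    1 fun f => by rw [one_mul]; exact norm_mollify_le hcont φ f

theorem mollifyCLM_apply (f : H0 P) : mollifyCLM hcont φ f = mollify φ f := rfl

theorem translate_mollify (x : Fin d → ℝ) (f : H0 P) :
    translate P x (mollify φ f) = ∫ t, φ.normed volume t • translate P (x - t) f := by
  rw [mollify, ← translateCLM_apply, ← ContinuousLinearMap.integral_comp_comm _
    (integrable_mollify hcont φ f)]
  refine integral_congr_ae (Eventually.of_forall fun t => ?_)
  refine (map_smul (translateCLM P x) _ _).trans ?_
  rw [translateCLM_apply, translate_translate, ← sub_eq_add_neg]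

theorem mollify_translate (x : Fin d → ℝ) (f : H0 P) :
    mollify φ (translate P x f) = translate P x (mollify φ f) := by
  rw [translate_mollify hcont, mollify]
  simp only [translate_translate, neg_add_eq_sub]

theorem inner_mollify_right (f g : H0 P) :
    inner ℂ f (mollify φ g) = ∫ t, (φ.normed volume t : ℂ) * inner ℂ f (translate P (-t) g) := by
  have h := (innerSL ℂ f).integral_comp_comm (integrable_mollify hcont φ g)
  rw [mollify]
  refine h.symm.trans (integral_congr_ae (Eventually.of_forall fun t => ?_))
  change inner ℂ f _ = _
  rw [inner_smul_right_eq_smul, Complex.real_smul]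

/-- The adjoint of a translation is the opposite translation, and the bump function is real and
even. -/
theorem inner_mollify_left (f g : H0 P) : inner ℂ (mollify φ f) g = inner ℂ f (mollify φ g) := by
  rw [inner_mollify_right hcont, ← inner_conj_symm, inner_mollify_right hcont, ← integral_conj,
    ← integral_neg_eq_self]
  refine integral_congr_ae (Eventually.of_forall fun t => ?_)
  simp only [map_mul, Complex.conj_ofReal, φ.normed_neg, inner_conj_symm, neg_neg,
    inner_translate_left]

theorem mollify_const (c : ℂ) : mollify φ (Lp.const 2 P c) = Lp.const 2 P c := by
  rw [mollify]
  simp only [translate_const]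
  rw [integral_smul_const, φ.integral_normed, one_smul]

theorem integral_mollify (f : H0 P) : ∫ ω, mollify φ f ω ∂P = ∫ ω, f ω ∂P := by
  rw [integral_eq_inner_const, ← inner_mollify_left hcont, mollify_const hcont,
    integral_eq_inner_const]

theorem IsPartial.mollify {i : Fin d} {f f' : H0 P} (h : IsPartial i f f') :
    IsPartial i (mollify φ f) (mollify φ f') :=
  h.map (M := mollifyCLM hcont φ) (mollify_translate hcont φ)

open scoped ContDiff Convolution in
-- The orbit of a mollified element is the convolution of a smooth, compactly supported kernel with
-- the continuous orbit of f.
theorem contDiff_translate_mollify (f : H0 P) :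
    ContDiff ℝ ∞ fun x : Fin d → ℝ => translate P x (mollify φ f) := by
  have h : (fun x : Fin d → ℝ => translate P x (Polycrystal.mollify φ f)) =
      φ.normed volume ⋆[ContinuousLinearMap.lsmul ℝ ℝ, volume] fun x => translate P x f := by
    ext1 x
    rw [translate_mollify hcont]
    rfl
  rw [h]
  exact φ.hasCompactSupport_normed.contDiff_convolution_left _ φ.contDiff_normed
    (hcont f).locallyIntegrable

end Mollify

end Translation

/-! ### Invariant functions under an ergodic action -/

section Ergodic

variable {Ω : Type*} [MeasurableSpace Ω] {P : Measure Ω} [IsProbabilityMeasure P] {d : ℕ}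
  [AddAction (Fin d → ℝ) Ω] [MeasurableConstVAdd (Fin d → ℝ) Ω] [ErgodicVAdd (Fin d → ℝ) Ω P]

/-- Invariance holds only almost everywhere, with a null set depending on x. This still makes every
preimage of a measurable set almost invariant, so it is null or conull by ergodicity; measurable
sets of ℂ separate points countably, which pins down one value. -/
theorem eq_const_of_translate_eq {f : H0 P}
    (h : ∀ x : Fin d → ℝ, translate P x f = f) : ∃ c : ℂ, f = Lp.const 2 P c := by
  have hm : Measurable f := (Lp.stronglyMeasurable f).measurable
  obtain ⟨c, hc⟩ := Filter.exists_eventuallyEq_const_of_forall_separating (l := ae P) (f := f)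
    MeasurableSet fun U hU => by
      have hinv : ∀ x : Fin d → ℝ, (x +ᵥ · : Ω → Ω) ⁻¹' (f ⁻¹' U) =ᵐ[P] f ⁻¹' U := fun x => by
        have h1 := coeFn_translate (-x) f
        rw [h, neg_neg] at h1
        refine Filter.EventuallyEq.symm (h1.mono fun ω h2 => ?_)
        change (f ω ∈ U) = (f (x +ᵥ ω) ∈ U)
        rw [h2]
      have hconst := aeconst_of_forall_preimage_vadd_ae_eq (Fin d → ℝ)
        (hm hU).nullMeasurableSet hinv
      rcases Filter.eventuallyConst_set.1 hconst with h3 | h3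
      · exact Or.inl h3
      · exact Or.inr h3
  refine ⟨c, Lp.ext ?_⟩
  exact hc.trans (Lp.coeFn_const 2 P c).symm

end Ergodic

/-! ### Smooth fields -/

section Smooth

set_option linter.unusedSectionVars false

variable {Ω : Type*} [MeasurableSpace Ω] {P : Measure Ω} [IsProbabilityMeasure P] {d : ℕ}
  [AddAction (Fin d → ℝ) Ω] [MeasurableConstVAdd (Fin d → ℝ) Ω]
  [VAddInvariantMeasure (Fin d → ℝ) Ω P]

open scoped ContDiff in
/-- `x ↦ T_x f` is smooth. -/
def IsSmooth (d : ℕ) [AddAction (Fin d → ℝ) Ω] [MeasurableConstVAdd (Fin d → ℝ) Ω]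
    [VAddInvariantMeasure (Fin d → ℝ) Ω P] (f : H0 P) : Prop :=
  ContDiff ℝ ∞ fun x : Fin d → ℝ => translate P x f

/-- The partial derivative of a smooth scalar field. -/
def partialDeriv (i : Fin d) (f : H0 P) : H0 P :=
  fderiv ℝ (fun x : Fin d → ℝ => translate P x f) 0 (Pi.single i 1)

/-- The gradient of a smooth scalar field. -/
def gradient (d : ℕ) [AddAction (Fin d → ℝ) Ω] [MeasurableConstVAdd (Fin d → ℝ) Ω]
    [VAddInvariantMeasure (Fin d → ℝ) Ω P] (f : H0 P) : Hvec P d :=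
  WithLp.toLp 2 fun i => partialDeriv i f

theorem IsSmooth.differentiable {f : H0 P} (h : IsSmooth d f) :
    Differentiable ℝ fun x : Fin d → ℝ => translate P x f :=
  ContDiff.differentiable h (by simp)

theorem IsSmooth.isGrad {f : H0 P} (h : IsSmooth d f) : IsGrad f (gradient d f) := by
  intro i
  have h1 : HasDerivAt (fun t : ℝ => (Pi.single i t : Fin d → ℝ)) (Pi.single i 1) 0 := by
    refine hasDerivAt_pi.2 fun j => ?_
    by_cases hij : j = i
    · subst hij
      simpa using hasDerivAt_id' (0 : ℝ)
    · simpa [hij] using hasDerivAt_const (0 : ℝ) (0 : ℝ)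
  have h2 : HasFDerivAt (fun x : Fin d → ℝ => translate P x f)
      (fderiv ℝ (fun x : Fin d → ℝ => translate P x f) 0) (Pi.single i (0 : ℝ)) := by
    rw [Pi.single_zero]
    exact (h.differentiable 0).hasFDerivAt
  exact h2.comp_hasDerivAt (0 : ℝ) h1

theorem IsSmooth.translate_partialDeriv {f : H0 P} (h : IsSmooth d f) (i : Fin d)
    (x : Fin d → ℝ) : translate P x (partialDeriv i f) =
      fderiv ℝ (fun x : Fin d → ℝ => translate P x f) x (Pi.single i 1) := by
  have h1 := fderiv_comp_add_left (𝕜 := ℝ) (f := fun y : Fin d → ℝ => translate P y f) (x := 0) x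
  rw [add_zero] at h1
  have h2 : (fun y : Fin d → ℝ => translate P (x + y) f) =
      (translateCLM P x) ∘ fun y : Fin d → ℝ => translate P y f := by
    ext1 y
    exact (translate_translate x y f).symm
  rw [← h1, h2, ((translateCLM P x).hasFDerivAt.comp (0 : Fin d → ℝ)
    (h.differentiable 0).hasFDerivAt).fderiv]
  rfl

theorem IsSmooth.partialDeriv {f : H0 P} (h : IsSmooth d f) (i : Fin d) :
    IsSmooth d (partialDeriv i f) := by
  rw [IsSmooth]
  simp only [h.translate_partialDeriv]
  exact (ContDiff.fderiv_right h (by simp)).clm_apply contDiff_const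

theorem isJacobian_of_isSmooth {ξ : Hvec P d} (h : ∀ i, IsSmooth d (ξ i)) :
    IsJacobian ξ fun i => gradient d (ξ i) :=
  fun i => (h i).isGrad

theorem IsGrad.add {f f' : H0 P} {g g' : Hvec P d} (h : IsGrad f g) (h' : IsGrad f' g') :
    IsGrad (f + f') (g + g') :=
  fun i => (h i).add (h' i)

theorem IsGrad.smul {f : H0 P} {g : Hvec P d} (c : ℂ) (h : IsGrad f g) :
    IsGrad (c • f) (c • g) :=
  fun i => (h i).smul c

theorem IsGrad.const (c : ℂ) : IsGrad (Lp.const 2 P c) (0 : Hvec P d) :=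
  fun i => IsPartial.const i c

theorem IsJacobian.add {ξ ζ : Hvec P d} {D D' : Fin d → Hvec P d} (h : IsJacobian ξ D)
    (h' : IsJacobian ζ D') : IsJacobian (ξ + ζ) (D + D') :=
  fun i => (h i).add (h' i)

theorem IsJacobian.smul {ξ : Hvec P d} {D : Fin d → Hvec P d} (c : ℂ) (h : IsJacobian ξ D) :
    IsJacobian (c • ξ) (c • D) :=
  fun i => (h i).smul c

theorem IsJacobian.neg {ξ : Hvec P d} {D : Fin d → Hvec P d} (h : IsJacobian ξ D) :
    IsJacobian (-ξ) (-D) :=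
  fun i => (h i).neg

theorem integral_add' (f g : H0 P) : ∫ ω, (f + g : H0 P) ω ∂P = ∫ ω, f ω ∂P + ∫ ω, g ω ∂P := by
  simp only [integral_eq_inner_const, inner_add_right]

theorem integral_smul' (c : ℂ) (f : H0 P) : ∫ ω, (c • f : H0 P) ω ∂P = c * ∫ ω, f ω ∂P := by
  simp only [integral_eq_inner_const, inner_smul_right]

theorem integral_const' (c : ℂ) : ∫ ω, (Lp.const 2 P c : H0 P) ω ∂P = c := by
  rw [integral_congr_ae (Lp.coeFn_const 2 P c)]
  simp

theorem MemH2.add {f g : H0 P} (h : MemH2 d f) (h' : MemH2 d g) : MemH2 d (f + g) := by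
  obtain ⟨h0, g, D, hg, hD⟩ := h
  obtain ⟨h0', g', D', hg', hD'⟩ := h'
  exact ⟨by rw [integral_add', h0, h0', add_zero], g + g', D + D', hg.add hg', hD.add hD'⟩

theorem MemH2.smul {f : H0 P} (c : ℂ) (h : MemH2 d f) : MemH2 d (c • f) := by
  obtain ⟨h0, g, D, hg, hD⟩ := h
  exact ⟨by rw [integral_smul', h0, mul_zero], c • g, c • D, hg.smul c, hD.smul c⟩

theorem IsSmooth.memH2 {f : H0 P} (h : IsSmooth d f) :
    MemH2 d (f - Lp.const 2 P (∫ ω, f ω ∂P)) := by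
  refine ⟨?_, gradient d f, _, ?_, isJacobian_of_isSmooth fun i => h.partialDeriv i⟩
  · rw [sub_eq_add_neg, ← map_neg, integral_add', integral_const', add_neg_cancel]
  · have h1 := h.isGrad.add (IsGrad.const (P := P) (d := d) (-∫ ω, f ω ∂P))
    rw [add_zero, map_neg, ← sub_eq_add_neg] at h1
    exact h1

theorem IsGrad.sub_mean {f : H0 P} {g : Hvec P d} (h : IsGrad f g) :
    IsGrad (f - Lp.const 2 P (∫ ω, f ω ∂P)) g := by
  have h1 := h.add (IsGrad.const (P := P) (d := d) (-∫ ω, f ω ∂P))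
  rw [add_zero, map_neg, ← sub_eq_add_neg] at h1
  exact h1

/-- A sequence of mollifiers. -/
def bump (d n : ℕ) : ContDiffBump (0 : Fin d → ℝ) where
  rIn := 1 / ((n : ℝ) + 2)
  rOut := 1 / ((n : ℝ) + 1)
  rIn_pos := by positivity
  rIn_lt_rOut := one_div_lt_one_div_of_lt (by positivity) (by linarith)

/-- Mollification of a vector field. -/
def mollifyField (n : ℕ) (ξ : Hvec P d) : Hvec P d :=
  WithLp.toLp 2 fun i => mollify (bump d n) (ξ i)

@[simp] theorem mollifyField_apply (n : ℕ) (ξ : Hvec P d) (i : Fin d) :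
    mollifyField n ξ i = mollify (bump d n) (ξ i) := rfl

variable (hcont : ∀ f : H0 P, Continuous fun x : Fin d → ℝ => translate P x f)

include hcont

theorem tendsto_mollify (f : H0 P) :
    Tendsto (fun n => mollify (bump d n) f) atTop (𝓝 f) := by
  have h := ContDiffBump.convolution_tendsto_right_of_continuous (μ := volume) (φ := bump d)
    tendsto_one_div_add_atTop_nhds_zero_nat (hcont f) 0
  rw [translate_zero] at h
  refine h.congr fun n => ?_
  rw [mollify]
  simp only [convolution_def, zero_sub]
  rfl

theorem tendsto_mollifyField (ξ : Hvec P d) :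
    Tendsto (fun n => mollifyField n ξ) atTop (𝓝 ξ) :=
  ((PiLp.continuous_toLp 2 _).tendsto (WithLp.ofLp ξ)).comp
    (tendsto_pi_nhds.2 fun i => tendsto_mollify hcont (ξ i))

theorem isSmooth_mollify (n : ℕ) (f : H0 P) : IsSmooth d (mollify (bump d n) f) :=
  contDiff_translate_mollify hcont _ f

theorem IsGrad.mollify {f : H0 P} {g : Hvec P d} (h : IsGrad f g) (n : ℕ) :
    IsGrad (mollify (bump d n) f) (mollifyField n g) :=
  fun i => (h i).mollify hcont _

theorem exists_isJacobian_mollifyField (n : ℕ) (ξ : Hvec P d) :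
    ∃ D, IsJacobian (mollifyField n ξ) D :=
  ⟨_, isJacobian_of_isSmooth fun i => isSmooth_mollify hcont n (ξ i)⟩

theorem inner_mollifyField_left (n : ℕ) (ξ ζ : Hvec P d) :
    inner ℂ (mollifyField n ξ) ζ = inner ℂ ξ (mollifyField n ζ) := by
  simp only [Hvec.inner_def, mollifyField_apply, inner_mollify_left hcont]

theorem IsDivFree.mollifyField {ζ : Hvec P d} (h : IsDivFree ζ) (n : ℕ) :
    IsDivFree (mollifyField n ζ) := fun φ g hg => by
  rw [← inner_mollifyField_left hcont]
  exact h _ _ (hg.mollify hcont n)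

theorem IsCurlFree.mollifyField {ξ : Hvec P d} (h : IsCurlFree ξ) (n : ℕ) :
    IsCurlFree (mollifyField n ξ) := fun φ g hg i j => by
  simp only [mollifyField_apply, ← inner_mollify_left hcont]
  exact h _ _ (hg.mollify hcont n) i j

/-- A field orthogonal to all differentiable fields vanishes. -/
theorem eq_zero_of_inner_isGrad {h : H0 P}
    (hh : ∀ (f : H0 P) (g : Hvec P d), IsGrad f g → inner ℂ f h = 0) : h = 0 := by
  have h1 := (tendsto_mollify hcont h).inner (𝕜 := ℂ) (tendsto_const_nhds (x := h))
  have h2 : ∀ n, inner ℂ (mollify (bump d n) h) h = 0 := fun n =>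
    hh _ _ (isSmooth_mollify hcont n h).isGrad
  simp only [h2] at h1
  exact inner_self_eq_zero.1 (tendsto_nhds_unique h1 tendsto_const_nhds)

theorem IsDivFree.sum_jacobian {ζ : Hvec P d} {D : Fin d → Hvec P d} (h : IsDivFree ζ)
    (hD : IsJacobian ζ D) : ∑ i, D i i = 0 := by
  refine eq_zero_of_inner_isGrad hcont fun f g hg => ?_
  have h1 := h f g hg
  rw [Hvec.inner_def] at h1
  rw [inner_sum, ← neg_inj, neg_zero, ← h1, ← Finset.sum_neg_distrib]
  exact Finset.sum_congr rfl fun i _ => ((hg i).inner_left (hD i i)).symm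

theorem IsCurlFree.jacobian_symm {ξ : Hvec P d} {D : Fin d → Hvec P d} (h : IsCurlFree ξ)
    (hD : IsJacobian ξ D) (i j : Fin d) : D j i = D i j := by
  rw [← sub_eq_zero]
  refine eq_zero_of_inner_isGrad hcont fun f g hg => ?_
  have h1 := h f g hg i j
  rw [(hg i).inner_left (hD j i), (hg j).inner_left (hD i j), neg_inj] at h1
  rw [inner_sub_right, h1, sub_self]

omit hcont

theorem isDivFree_of_jacobian {ζ : Hvec P d} {D : Fin d → Hvec P d} (hD : IsJacobian ζ D)
    (h : ∑ i, D i i = 0) : IsDivFree ζ := fun f g hg => by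
  have h1 : inner ℂ g ζ = -inner ℂ f (∑ i, D i i) := by
    rw [Hvec.inner_def, inner_sum, ← Finset.sum_neg_distrib]
    exact Finset.sum_congr rfl fun i _ => (hg i).inner_left (hD i i)
  rw [h1, h, inner_zero_right, neg_zero]

theorem isCurlFree_of_jacobian {ξ : Hvec P d} {D : Fin d → Hvec P d} (hD : IsJacobian ξ D)
    (h : ∀ i j, D j i = D i j) : IsCurlFree ξ := fun f g hg i j => by
  rw [(hg i).inner_left (hD j i), (hg j).inner_left (hD i j), h i j]

theorem IsGrad.isCurlFree {f : H0 P} {g : Hvec P d} (h : IsGrad f g) : IsCurlFree g :=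
  fun _ _ hg i j => (hg i).inner_symm (hg j) (h i) (h j)

theorem IsGrad.mean_eq_zero {f : H0 P} {g : Hvec P d} (h : IsGrad f g) : mean g = 0 :=
  funext fun i => (h i).integral_eq_zero

end Smooth

/-! ### The Helmholtz decomposition -/

section Mean

variable {Ω : Type*} [MeasurableSpace Ω] {P : Measure Ω} [IsProbabilityMeasure P] {d : ℕ}

theorem mean_add (ξ ζ : Hvec P d) : mean (ξ + ζ) = mean ξ + mean ζ := by
  ext k
  simp only [← inner_basisField_left P, Pi.add_apply, inner_add_right]

theorem mean_smul (c : ℂ) (ξ : Hvec P d) : mean (c • ξ) = c • mean ξ := by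
  ext k
  simp only [← inner_basisField_left P, Pi.smul_apply, inner_smul_right, smul_eq_mul]

theorem continuous_mean_apply (k : Fin d) : Continuous fun ξ : Hvec P d => mean ξ k := by
  simp only [← inner_basisField_left P]
  fun_prop

theorem isClosed_mean_eq_zero : IsClosed {ξ : Hvec P d | mean ξ = 0} := by
  simp only [funext_iff]
  rw [Set.ofPred_forall]
  exact isClosed_iInter fun k => isClosed_eq (continuous_mean_apply k) continuous_const

end Mean

section Spaces

set_option linter.unusedSectionVars false

variable {Ω : Type*} [MeasurableSpace Ω] {P : Measure Ω} [IsProbabilityMeasure P] {d : ℕ}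
  [AddAction (Fin d → ℝ) Ω] [MeasurableConstVAdd (Fin d → ℝ) Ω]
  [VAddInvariantMeasure (Fin d → ℝ) Ω P]

variable (P d) in
/-- The closed subspace of curl-free fields of mean zero. -/
def curlFreeSub : Submodule ℂ (Hvec P d) where
  carrier := curlFreeSpace P d
  add_mem' := by
    rintro ξ ζ ⟨h1, h2⟩ ⟨h3, h4⟩
    refine ⟨fun φ g hg i j => ?_, by rw [mean_add, h2, h4, add_zero]⟩
    rw [PiLp.add_apply, PiLp.add_apply, inner_add_right, inner_add_right, h1 φ g hg, h3 φ g hg]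
  zero_mem' := ⟨fun φ g hg i j => by simp, by ext k; simp [← inner_basisField_left P]⟩
  smul_mem' := by
    rintro c ξ ⟨h1, h2⟩
    refine ⟨fun φ g hg i j => ?_, by rw [mean_smul, h2, smul_zero]⟩
    rw [PiLp.smul_apply, PiLp.smul_apply, inner_smul_right, inner_smul_right, h1 φ g hg]

variable (P d) in
/-- The closed subspace of divergence-free fields of mean zero. -/
def divFreeSub : Submodule ℂ (Hvec P d) where
  carrier := divFreeSpace P d
  add_mem' := by
    rintro ξ ζ ⟨h1, h2⟩ ⟨h3, h4⟩
    refine ⟨fun φ g hg => ?_, by rw [mean_add, h2, h4, add_zero]⟩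
    rw [inner_add_right, h1 φ g hg, h3 φ g hg, add_zero]
  zero_mem' := ⟨fun φ g hg => by simp, by ext k; simp [← inner_basisField_left P]⟩
  smul_mem' := by
    rintro c ξ ⟨h1, h2⟩
    refine ⟨fun φ g hg => ?_, by rw [mean_smul, h2, smul_zero]⟩
    rw [inner_smul_right, h1 φ g hg, mul_zero]

theorem isClosed_curlFreeSub : IsClosed (curlFreeSub P d : Set (Hvec P d)) := by
  refine IsClosed.inter ?_ isClosed_mean_eq_zero
  change IsClosed {ξ : Hvec P d | ∀ (φ : H0 P) (g : Hvec P d), IsGrad φ g →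
    ∀ i j, inner ℂ (g i) (ξ j) = inner ℂ (g j) (ξ i)}
  simp only [Set.ofPred_forall]
  have hc : ∀ i, Continuous fun ξ : Hvec P d => ξ i := fun i => PiLp.continuous_apply 2 _ i
  exact isClosed_iInter fun φ => isClosed_iInter fun g => isClosed_iInter fun _ =>
    isClosed_iInter fun i => isClosed_iInter fun j =>
      isClosed_eq (continuous_const.inner (hc j)) (continuous_const.inner (hc i))

theorem isClosed_divFreeSub : IsClosed (divFreeSub P d : Set (Hvec P d)) := by
  refine IsClosed.inter ?_ isClosed_mean_eq_zero
  change IsClosed {ζ : Hvec P d | ∀ (φ : H0 P) (g : Hvec P d), IsGrad φ g → inner ℂ g ζ = 0}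
  simp only [Set.ofPred_forall]
  exact isClosed_iInter fun φ => isClosed_iInter fun g => isClosed_iInter fun _ =>
    isClosed_eq (by fun_prop) continuous_const

instance : CompleteSpace (curlFreeSub P d) := isClosed_curlFreeSub.completeSpace_coe

instance : CompleteSpace (divFreeSub P d) := isClosed_divFreeSub.completeSpace_coe

variable (P d) in
/-- The space of gradients. -/
def gradRange : Submodule ℂ (Hvec P d) := Submodule.span ℂ {g | ∃ f, IsGrad f g}

/-- The field `K* v`, where `v` has the entries `f` and `-f` at `(j, i)` and `(i, j)`. -/
def rotField (g : Hvec P d) (i j : Fin d) : Hvec P d :=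
  WithLp.toLp 2 (Pi.single j (g i) - Pi.single i (g j))

variable (P d) in
/-- The range of the adjoint of the curl. -/
def rotRange : Submodule ℂ (Hvec P d) :=
  Submodule.span ℂ {b | ∃ f g, IsGrad f g ∧ ∃ i j, b = rotField g i j}

theorem rotField_apply (g : Hvec P d) (i j q : Fin d) :
    rotField g i j q = (if q = j then g i else 0) - if q = i then g j else 0 := by
  simp [rotField]

theorem inner_single_left (j : Fin d) (u : H0 P) (ξ : Hvec P d) :
    inner ℂ (WithLp.toLp 2 (Pi.single j u) : Hvec P d) ξ = inner ℂ u (ξ j) := by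
  rw [Hvec.inner_def, Finset.sum_eq_single j]
  · simp
  · intro i _ h
    simp [h]
  · simp

theorem inner_rotField_left (g : Hvec P d) (i j : Fin d) (ξ : Hvec P d) :
    inner ℂ (rotField g i j) ξ = inner ℂ (g i) (ξ j) - inner ℂ (g j) (ξ i) := by
  rw [rotField, WithLp.toLp_sub, inner_sub_left, inner_single_left, inner_single_left]

theorem mem_orthogonal_gradRange {ζ : Hvec P d} : ζ ∈ (gradRange P d)ᗮ ↔ IsDivFree ζ := by
  rw [gradRange, Submodule.mem_orthogonal]
  constructor
  · exact fun h φ g hg => h g (Submodule.subset_span ⟨φ, hg⟩)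
  · intro h g hg
    induction hg using Submodule.span_induction with
    | mem g hg => exact h _ _ hg.choose_spec
    | zero => exact inner_zero_left _
    | add x y _ _ hx hy => rw [inner_add_left, hx, hy, add_zero]
    | smul c x _ hx => rw [inner_smul_left, hx, mul_zero]

theorem mem_orthogonal_rotRange {ξ : Hvec P d} : ξ ∈ (rotRange P d)ᗮ ↔ IsCurlFree ξ := by
  rw [rotRange, Submodule.mem_orthogonal]
  constructor
  · intro h φ g hg i j
    have h1 := h _ (Submodule.subset_span ⟨φ, g, hg, i, j, rfl⟩)
    rwa [inner_rotField_left, sub_eq_zero] at h1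
  · intro h b hb
    induction hb using Submodule.span_induction with
    | mem b hb =>
      obtain ⟨φ, g, hg, i, j, rfl⟩ := hb
      rw [inner_rotField_left, h φ g hg, sub_self]
    | zero => exact inner_zero_left _
    | add x y _ _ hx hy => rw [inner_add_left, hx, hy, add_zero]
    | smul c x _ hx => rw [inner_smul_left, hx, mul_zero]

theorem mean_eq_zero_iff {ξ : Hvec P d} :
    mean ξ = 0 ↔ ∀ c : Fin d → ℂ, inner ℂ (constField P c) ξ = 0 := by
  constructor
  · intro h c
    rw [inner_constField_left, h]
    simp
  · intro h
    ext k
    rw [← inner_basisField_left P]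
    exact h _

theorem gradRange_le : gradRange P d ≤ curlFreeSub P d := by
  refine Submodule.span_le.2 ?_
  rintro g ⟨f, hf⟩
  exact ⟨hf.isCurlFree, hf.mean_eq_zero⟩

/-- Pairing with a gradient gives zero by `IsPartial.inner_symm`, and pairing with a constant gives
zero by integration by parts. -/
theorem rotField_mem {f : H0 P} {g : Hvec P d} (hg : IsGrad f g) (i j : Fin d) :
    rotField g i j ∈ divFreeSpace P d := by
  constructor
  · intro φ γ hγ
    rw [← inner_conj_symm, inner_rotField_left, (hg i).inner_symm (hg j) (hγ i) (hγ j), sub_self,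
      map_zero]
  · rw [mean_eq_zero_iff]
    intro c
    rw [← inner_conj_symm, inner_rotField_left]
    have h : ∀ i j, inner ℂ (g i) (constField P c j) = 0 := fun i j => by
      refine ((hg i).inner_left (IsPartial.const i (c j))).trans ?_
      rw [inner_zero_right, neg_zero]
    rw [h, h, sub_self, map_zero]

theorem rotRange_le : rotRange P d ≤ divFreeSub P d := by
  refine Submodule.span_le.2 ?_
  rintro b ⟨f, g, hg, i, j, rfl⟩
  exact rotField_mem hg i j

end Spaces

section Decomposition

set_option linter.unusedSectionVars false

variable {Ω : Type*} [MeasurableSpace Ω] {P : Measure Ω} [IsProbabilityMeasure P] {d : ℕ}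
  [AddAction (Fin d → ℝ) Ω] [MeasurableConstVAdd (Fin d → ℝ) Ω]
  [ErgodicVAdd (Fin d → ℝ) Ω P]
  (hcont : ∀ f : H0 P, Continuous fun x : Fin d → ℝ => translate P x f)

include hcont

/-- Mollification preserves all three conditions and makes them hold for actual derivatives. This is
the point where ergodicity enters: without it nonconstant invariant fields would survive. -/
theorem eq_zero_of_isCurlFree_of_isDivFree {ξ : Hvec P d} (hc : IsCurlFree ξ) (hd : IsDivFree ξ)
    (hm : mean ξ = 0) : ξ = 0 := by
  have hz : ∀ n, mollifyField n ξ = 0 := by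
    intro n
    obtain ⟨D, hD⟩ := exists_isJacobian_mollifyField hcont n ξ
    have hsymm := (hc.mollifyField hcont n).jacobian_symm hcont hD
    have hdiv := (hd.mollifyField hcont n).sum_jacobian hcont hD
    ext1 i
    have hDi : D i = 0 := by
      rw [← inner_self_eq_zero (𝕜 := ℂ), Hvec.inner_def]
      -- Curl-freeness replaces one factor L_jξ_i by L_iξ_j, and exchanging the derivatives then
      -- produces ⟨L_iξ_i, L_jξ_j⟩, whose sum over j contains the divergence.
      calc ∑ j, inner ℂ (D i j) (D i j) = ∑ j, inner ℂ (D i i) (D j j) := by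
            refine Finset.sum_congr rfl fun j _ => ?_
            calc inner ℂ (D i j) (D i j) = inner ℂ (D i j) (D j i) := by rw [hsymm i j]
              _ = _ := (hD i j).inner_symm (hD i i) (hD j j) (hD j i)
        _ = inner ℂ (D i i) (∑ j, D j j) := (inner_sum _ _ _).symm
        _ = 0 := by rw [hdiv, inner_zero_right]
    have hgrad := hD i
    rw [hDi] at hgrad
    obtain ⟨c, hcst⟩ := eq_const_of_translate_eq (translate_eq_of_isGrad_zero hgrad)
    have hmi : ∫ ω, mollifyField n ξ i ω ∂P = 0 := by
      rw [mollifyField_apply, integral_mollify hcont]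
      exact congrFun hm i
    rw [hcst, integral_const'] at hmi
    rw [hcst, hmi, map_zero]
    rfl
  have h := tendsto_mollifyField hcont ξ
  simp only [hz] at h
  exact tendsto_nhds_unique h tendsto_const_nhds

/-- Inside the curl-free fields of mean zero, a field orthogonal to all gradients is also
divergence-free, hence zero. -/
theorem curlFreeSub_eq : (gradRange P d).topologicalClosure = curlFreeSub P d := by
  have hle : (gradRange P d).topologicalClosure ≤ curlFreeSub P d :=
    Submodule.topologicalClosure_minimal _ gradRange_le isClosed_curlFreeSub
  have : CompleteSpace (gradRange P d).topologicalClosure :=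
    (Submodule.isClosed_topologicalClosure _).completeSpace_coe
  have h := Submodule.sup_orthogonal_inf_of_hasOrthogonalProjection hle
  rw [Submodule.orthogonal_closure] at h
  have h0 : (gradRange P d)ᗮ ⊓ curlFreeSub P d = ⊥ := by
    rw [eq_bot_iff]
    rintro ξ ⟨h1, h2, h3⟩
    exact eq_zero_of_isCurlFree_of_isDivFree hcont h2 (mem_orthogonal_gradRange.1 h1) h3
  rwa [h0, sup_bot_eq] at h

/-- The dual argument: orthogonality to all rotations is weak curl-freeness. -/
theorem divFreeSub_eq : (rotRange P d).topologicalClosure = divFreeSub P d := by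
  have hle : (rotRange P d).topologicalClosure ≤ divFreeSub P d :=
    Submodule.topologicalClosure_minimal _ rotRange_le isClosed_divFreeSub
  have : CompleteSpace (rotRange P d).topologicalClosure :=
    (Submodule.isClosed_topologicalClosure _).completeSpace_coe
  have h := Submodule.sup_orthogonal_inf_of_hasOrthogonalProjection hle
  rw [Submodule.orthogonal_closure] at h
  have h0 : (rotRange P d)ᗮ ⊓ divFreeSub P d = ⊥ := by
    rw [eq_bot_iff]
    rintro ξ ⟨h1, h2, h3⟩
    exact eq_zero_of_isCurlFree_of_isDivFree hcont (mem_orthogonal_rotRange.1 h1) h2 h3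
  rwa [h0, sup_bot_eq] at h

theorem mem_orthogonal_curlFreeSub {ζ : Hvec P d} : ζ ∈ (curlFreeSub P d)ᗮ ↔ IsDivFree ζ := by
  rw [← curlFreeSub_eq hcont, Submodule.orthogonal_closure, mem_orthogonal_gradRange]

theorem mem_orthogonal_divFreeSub {ξ : Hvec P d} : ξ ∈ (divFreeSub P d)ᗮ ↔ IsCurlFree ξ := by
  rw [← divFreeSub_eq hcont, Submodule.orthogonal_closure, mem_orthogonal_rotRange]

end Decomposition

/-! ### The operators `Γ` and `Υ` as orthogonal projections -/

section Projections

set_option linter.unusedSectionVars false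

variable {Ω : Type*} [MeasurableSpace Ω] {P : Measure Ω} [IsProbabilityMeasure P] {d : ℕ}
  [AddAction (Fin d → ℝ) Ω] [MeasurableConstVAdd (Fin d → ℝ) Ω]

/-- The graph of `∇ (∇* ∇)⁻¹ ∇*` as a subspace. -/
def gradProjGraph [VAddInvariantMeasure (Fin d → ℝ) Ω P] : Submodule ℂ (Hvec P d × Hvec P d) where
  carrier := {p | IsGradProj p.1 p.2}
  add_mem' := by
    rintro ⟨ζ, η⟩ ⟨ζ', η'⟩ ⟨u, Dη, Dζ, h1, h2, h3, h4, h5⟩ ⟨u', Dη', Dζ', h1', h2', h3', h4', h5'⟩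
    refine ⟨u + u', Dη + Dη', Dζ + Dζ', by rw [integral_add', h1, h1', add_zero], h2.add h2',
      h3.add h3', h4.add h4', ?_⟩
    simp only [Pi.add_apply, PiLp.add_apply, Finset.sum_add_distrib, h5, h5']
  zero_mem' := by
    refine ⟨0, 0, 0, ?_, IsGrad.zero, fun i => IsGrad.zero, fun i => IsGrad.zero, rfl⟩
    rw [integral_eq_inner_const, inner_zero_right]
  smul_mem' := by
    rintro c ⟨ζ, η⟩ ⟨u, Dη, Dζ, h1, h2, h3, h4, h5⟩
    refine ⟨c • u, c • Dη, c • Dζ, by rw [integral_smul', h1, mul_zero], h2.smul c, h3.smul c,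
      h4.smul c, ?_⟩
    simp only [Pi.smul_apply, PiLp.smul_apply, ← Finset.smul_sum, h5]

/-- The graph of `K* (K K*)⁻¹ K` as a subspace. -/
def curlProjGraph [VAddInvariantMeasure (Fin d → ℝ) Ω P] : Submodule ℂ (Hvec P d × Hvec P d) where
  carrier := {p | IsCurlProj p.1 p.2}
  add_mem' := by
    rintro ⟨ζ, η⟩ ⟨ζ', η'⟩ ⟨v, Dv, Dη, Dζ, h1, h2, h3, h4, h5, h6, h7⟩
      ⟨v', Dv', Dη', Dζ', h1', h2', h3', h4', h5', h6', h7'⟩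
    refine ⟨v + v', Dv + Dv', Dη + Dη', Dζ + Dζ', fun i j => ?_, fun i j => (h2 i j).add (h2' i j),
      fun i j => (h3 i j).add (h3' i j), fun j => ?_, h5.add h5', h6.add h6', fun i j => ?_⟩
    · simp only [Pi.add_apply]
      rw [h1, h1', neg_add]
    · simp only [Pi.add_apply, PiLp.add_apply, Finset.sum_add_distrib, neg_add]
      rw [← h4, ← h4']
      rfl
    · simp only [Pi.add_apply, PiLp.add_apply]
      rw [add_sub_add_comm, h7, h7', add_sub_add_comm]
  zero_mem' := by
    refine ⟨0, 0, 0, 0, fun i j => ?_, fun i j => MemH2.zero, fun i j => IsGrad.zero, fun j => ?_,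
      fun i => IsGrad.zero, fun i => IsGrad.zero, fun i j => rfl⟩
    · simp
    · simp
  smul_mem' := by
    rintro c ⟨ζ, η⟩ ⟨v, Dv, Dη, Dζ, h1, h2, h3, h4, h5, h6, h7⟩
    refine ⟨c • v, c • Dv, c • Dη, c • Dζ, fun i j => ?_, fun i j => (h2 i j).smul c,
      fun i j => (h3 i j).smul c, fun j => ?_, h5.smul c, h6.smul c, fun i j => ?_⟩
    · simp only [Pi.smul_apply]
      rw [h1, smul_neg]
    · simp only [Pi.smul_apply, PiLp.smul_apply, ← Finset.smul_sum, ← smul_neg]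
      rw [← h4]
      rfl
    · simp only [Pi.smul_apply, PiLp.smul_apply, ← smul_sub]
      rw [h7]

variable [ErgodicVAdd (Fin d → ℝ) Ω P]

/-- The common argument for Γ and Υ. A point of the graph of the projection is (k, k) + (r, 0) with
k ∈ K and r ⟂ K, so it suffices to approximate these two kinds of pairs, the first only for k in a
dense subspace. Conversely `h1` puts G in the graph, which is closed. -/
theorem setOf_eq_closure {E : Type*} [NormedAddCommGroup E] [InnerProductSpace ℂ E]
    {K S : Submodule ℂ E} [K.HasOrthogonalProjection] (hK : S.topologicalClosure = K)
    (G : Submodule ℂ (E × E)) (h1 : ∀ p ∈ G, p.2 ∈ K ∧ p.1 - p.2 ∈ Kᗮ)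
    (h2 : ∀ g ∈ S, (g, g) ∈ G.topologicalClosure)
    (h3 : ∀ r ∈ Kᗮ, (r, 0) ∈ G.topologicalClosure) :
    {p : E × E | p.2 = K.starProjection p.1} = closure (G : Set (E × E)) := by
  apply Set.Subset.antisymm
  · rintro ⟨ζ, η⟩ (h : η = _)
    rw [h]
    have hdiag : ∀ g ∈ K, (g, g) ∈ G.topologicalClosure := by
      have hle : S.topologicalClosure ≤ G.topologicalClosure.comap
          ((LinearMap.id : E →ₗ[ℂ] E).prod LinearMap.id) :=
        Submodule.topologicalClosure_minimal _ h2
          (G.isClosed_topologicalClosure.preimage (by fun_prop : Continuous fun g : E => (g, g)))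
      rw [hK] at hle
      exact hle
    have h4 := G.topologicalClosure.add_mem (hdiag _ (K.starProjection_apply_mem ζ))
      (h3 _ (K.sub_starProjection_mem_orthogonal ζ))
    rw [Prod.mk_add_mk, add_sub_cancel, add_zero] at h4
    exact h4
  · refine closure_minimal ?_ (isClosed_eq (by fun_prop) (by fun_prop))
    intro p hp
    exact (Submodule.eq_starProjection_of_mem_orthogonal (h1 p hp).1 (h1 p hp).2).symm

variable (hcont : ∀ f : H0 P, Continuous fun x : Fin d → ℝ => translate P x f)

include hcont

theorem isGamma_starProjection : IsGamma (curlFreeSub P d).starProjection := by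
  refine setOf_eq_closure (curlFreeSub_eq hcont) gradProjGraph ?_ ?_ ?_
  · rintro ⟨ζ, η⟩ ⟨u, Dη, Dζ, h1, h2, h3, h4, h5⟩
    refine ⟨⟨h2.isCurlFree, h2.mean_eq_zero⟩, (mem_orthogonal_curlFreeSub hcont).2 ?_⟩
    change IsDivFree (ζ - η)
    rw [sub_eq_add_neg]
    refine isDivFree_of_jacobian (h4.add h3.neg) ?_
    simp only [Pi.add_apply, Pi.neg_apply, PiLp.add_apply, PiLp.neg_apply, Finset.sum_add_distrib,
      Finset.sum_neg_distrib, h5, add_neg_cancel]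
  · intro g hg
    induction hg using Submodule.span_induction with
    | mem g hg =>
      obtain ⟨f, hf⟩ := hg
      refine mem_closure_of_tendsto ((tendsto_mollifyField hcont g).prodMk_nhds
        (tendsto_mollifyField hcont g)) (Eventually.of_forall fun n => ?_)
      obtain ⟨D, hD⟩ := exists_isJacobian_mollifyField hcont n g
      -- A mollified gradient is its own image; the potential is the mollified f with its mean
      -- removed.
      refine ⟨_, D, D, ?_, (hf.mollify hcont n).sub_mean, hD, hD, rfl⟩
      rw [sub_eq_add_neg, ← map_neg, integral_add', integral_const', add_neg_cancel]
    | zero => exact Submodule.zero_mem _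
    | add x y _ _ hx hy => exact Submodule.add_mem _ hx hy
    | smul c x _ hx => exact Submodule.smul_mem _ c hx
  · intro r hr
    have hd := (mem_orthogonal_curlFreeSub hcont).1 hr
    refine mem_closure_of_tendsto ((tendsto_mollifyField hcont r).prodMk_nhds tendsto_const_nhds)
      (Eventually.of_forall fun n => ?_)
    obtain ⟨D, hD⟩ := exists_isJacobian_mollifyField hcont n r
    -- A mollified divergence-free field has zero source, so the potential 0 solves the equation.
    refine ⟨0, 0, D, ?_, IsGrad.zero, fun i => IsGrad.zero, hD, ?_⟩
    · rw [integral_eq_inner_const, inner_zero_right]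
    · rw [(hd.mollifyField hcont n).sum_jacobian hcont hD]
      simp

theorem isCurlProj_rotField {f : H0 P} {g : Hvec P d} (hf : MemH2 d f) (hg : IsGrad f g)
    (i j : Fin d) {D : Fin d → Hvec P d} (hD : IsJacobian (rotField g i j) D) :
    IsCurlProj (rotField g i j) (rotField g i j) := by
  classical
  -- The antisymmetric potential is f at (j, i) and -f at (i, j). Writing it as a sum of two terms
  -- makes it cancel when i = j, so that case needs no separate treatment.
  refine ⟨fun p q => (if p = j ∧ q = i then (1 : ℂ) else 0) • f +
      (if p = i ∧ q = j then (-1 : ℂ) else 0) • f,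
    fun p q => (if p = j ∧ q = i then (1 : ℂ) else 0) • g +
      (if p = i ∧ q = j then (-1 : ℂ) else 0) • g, D, D, fun p q => ?_,
    fun p q => (hf.smul _).add (hf.smul _), fun p q => (hg.smul _).add (hg.smul _), fun q => ?_,
    hD, hD, fun _ _ => rfl⟩
  · beta_reduce
    rw [← add_smul, ← add_smul, ← neg_smul]
    congr 1
    simp only [show (q = j ∧ p = i) ↔ (p = i ∧ q = j) from and_comm,
      show (q = i ∧ p = j) ↔ (p = j ∧ q = i) from and_comm]
    split_ifs <;> simp
  · have hs : ∀ (c : ℂ) (a b : Fin d), ∑ p, (if p = a ∧ q = b then c else 0) • g p =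
        if q = b then c • g a else 0 := fun c a b => by
      by_cases h : q = b <;> simp [h]
    simp only [PiLp.add_apply, PiLp.smul_apply, Finset.sum_add_distrib, hs, rotField_apply]
    rw [one_smul, neg_smul, one_smul]
    split_ifs <;> abel

theorem isUpsilon_starProjection : IsUpsilon (divFreeSub P d).starProjection := by
  refine setOf_eq_closure (divFreeSub_eq hcont) curlProjGraph ?_ ?_ ?_
  · rintro ⟨ζ, η⟩ ⟨v, Dv, Dη, Dζ, h1, h2, h3, h4, h5, h6, h7⟩
    have hD : ∀ p q, Dv p q = -Dv q p := fun p q => by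
      have h := (h3 q p).neg
      rw [← h1 p q] at h
      exact (h3 p q).unique h
    refine ⟨⟨?_, ?_⟩, (mem_orthogonal_divFreeSub hcont).2 ?_⟩
    · intro φ γ hγ
      change inner ℂ γ η = 0
      have hs : inner ℂ γ η = -∑ q, ∑ p, inner ℂ (γ q) (Dv p q p) := by
        rw [Hvec.inner_def, ← Finset.sum_neg_distrib]
        refine Finset.sum_congr rfl fun q _ => ?_
        rw [show η q = _ from h4 q, inner_neg_right, inner_sum]
      -- Exchanging derivatives makes the pairing symmetric in p and q, while v is antisymmetric, so
      -- the double sum equals its own negative.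
      have hx : ∑ q, ∑ p, inner ℂ (γ q) (Dv p q p) = -∑ q, ∑ p, inner ℂ (γ q) (Dv p q p) := by
        conv_rhs => rw [Finset.sum_comm]
        rw [← Finset.sum_neg_distrib]
        refine Finset.sum_congr rfl fun q _ => ?_
        rw [← Finset.sum_neg_distrib]
        refine Finset.sum_congr rfl fun p _ => ?_
        rw [(hγ q).inner_symm (hγ p) (h3 p q q) (h3 p q p), hD p q, PiLp.neg_apply, inner_neg_right]
      rw [hs, self_eq_neg.1 hx, neg_zero]
    · ext q
      change ∫ ω, η q ω ∂P = 0
      rw [show η q = _ from h4 q, integral_eq_inner_const, inner_neg_right, inner_sum,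
        Finset.sum_eq_zero, neg_zero]
      intro p _
      rw [← integral_eq_inner_const]
      exact (h3 p q p).integral_eq_zero
    · change IsCurlFree (ζ - η)
      rw [sub_eq_add_neg]
      refine isCurlFree_of_jacobian (h6.add h5.neg) fun i j => ?_
      have h := h7 i j
      simp only [Pi.add_apply, Pi.neg_apply, PiLp.add_apply, PiLp.neg_apply]
      rw [← sub_eq_zero] at h ⊢
      rw [← neg_eq_zero, ← h]
      abel
  · intro b hb
    induction hb using Submodule.span_induction with
    | mem b hb =>
      obtain ⟨f, g, hg, i, j, rfl⟩ := hb
      have h1 : ∀ n, mollifyField n (rotField g i j) = rotField (mollifyField n g) i j := by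
        intro n
        ext1 q
        rw [mollifyField_apply, rotField_apply, rotField_apply, ← mollifyCLM_apply hcont, map_sub,
          apply_ite (mollifyCLM hcont (bump d n)), apply_ite (mollifyCLM hcont (bump d n)), map_zero]
        rfl
      refine mem_closure_of_tendsto ((tendsto_mollifyField hcont _).prodMk_nhds
        (tendsto_mollifyField hcont _)) (Eventually.of_forall fun n => ?_)
      obtain ⟨D, hD⟩ := exists_isJacobian_mollifyField hcont n (rotField g i j)
      rw [h1] at hD ⊢
      exact isCurlProj_rotField hcont (isSmooth_mollify hcont n f).memH2
        (hg.mollify hcont n).sub_mean i j hD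
    | zero => exact Submodule.zero_mem _
    | add x y _ _ hx hy => exact Submodule.add_mem _ hx hy
    | smul c x _ hx => exact Submodule.smul_mem _ c hx
  · intro r hr
    have hc := (mem_orthogonal_divFreeSub hcont).1 hr
    refine mem_closure_of_tendsto ((tendsto_mollifyField hcont r).prodMk_nhds tendsto_const_nhds)
      (Eventually.of_forall fun n => ?_)
    obtain ⟨D, hD⟩ := exists_isJacobian_mollifyField hcont n r
    -- A mollified curl-free field has curl zero, so the tensor potential 0 suffices.
    refine ⟨0, 0, 0, D, fun i j => ?_, fun i j => MemH2.zero, fun i j => IsGrad.zero, fun j => ?_,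
      fun i => IsGrad.zero, hD, fun i j => ?_⟩
    · simp
    · simp
    · rw [(hc.mollifyField hcont n).jacobian_symm hcont hD, sub_self, Pi.zero_apply, Pi.zero_apply,
        PiLp.zero_apply, PiLp.zero_apply, sub_self]

end Projections

/-! ### Conjugation invariance -/

section Conjugation

set_option linter.unusedSectionVars false

/-- Being an antiunitary involution, C preserves Kᗮ along with K, so it respects the orthogonal
decomposition. -/
theorem map_starProjection_of_conj {H : Type*} [NormedAddCommGroup H] [InnerProductSpace ℂ H]
    {C : H →+ H} (hC : ∀ x y, inner ℂ (C x) (C y) = inner ℂ y x) (hCC : ∀ x, C (C x) = x)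
    {K : Submodule ℂ H} [K.HasOrthogonalProjection] (hK : ∀ x ∈ K, C x ∈ K) (x : H) :
    C (K.starProjection x) = K.starProjection (C x) := by
  refine Eq.symm (Submodule.eq_starProjection_of_mem_of_inner_eq_zero
    (hK _ (K.starProjection_apply_mem x)) fun w hw => ?_)
  rw [← map_sub, ← hCC w, hC]
  exact K.inner_right_of_mem_orthogonal (hK w hw) (K.sub_starProjection_mem_orthogonal x)

variable {Ω : Type*} [MeasurableSpace Ω] {P : Measure Ω} [IsProbabilityMeasure P] {d : ℕ}
  [AddAction (Fin d → ℝ) Ω] [MeasurableConstVAdd (Fin d → ℝ) Ω]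
  [VAddInvariantMeasure (Fin d → ℝ) Ω P]

theorem IsGrad.conj {f : H0 P} {g : Hvec P d} (h : IsGrad f g) :
    IsGrad (conjScalar P f) (conjField P g) :=
  fun i => (h i).map fun x f => conjScalar_translate x f

theorem mean_conjField {ξ : Hvec P d} (h : mean ξ = 0) : mean (conjField P ξ) = 0 := by
  ext k
  rw [← inner_basisField_left P, ← conjField_basisField P k, inner_conjField, ← inner_conj_symm,
    inner_basisField_left, h]
  simp

theorem conjField_mem_curlFreeSub {ξ : Hvec P d} (h : ξ ∈ curlFreeSub P d) :
    conjField P ξ ∈ curlFreeSub P d := by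
  refine ⟨fun φ g hg i j => ?_, mean_conjField h.2⟩
  have h1 : ∀ i j, inner ℂ (g i) (conjField P ξ j) =
      (starRingEnd ℂ) (inner ℂ (conjField P g i) (ξ j)) := fun i j => by
    rw [inner_conj_symm, conjField_apply, conjField_apply, ← inner_conjScalar P (conjScalar P (g i)),
      conjScalar_conjScalar]
  rw [h1, h1, h.1 _ _ hg.conj]

theorem conjField_mem_divFreeSub {ξ : Hvec P d} (h : ξ ∈ divFreeSub P d) :
    conjField P ξ ∈ divFreeSub P d := by
  refine ⟨fun φ g hg => ?_, mean_conjField h.2⟩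
  rw [← conjField_conjField P g, inner_conjField, ← inner_conj_symm, h.1 _ _ hg.conj, map_zero]

theorem constField_mem_orthogonal {K : Submodule ℂ (Hvec P d)} (hK : ∀ ξ ∈ K, mean ξ = 0)
    (c : Fin d → ℂ) : constField P c ∈ Kᗮ := fun ξ hξ => by
  rw [← inner_conj_symm, mean_eq_zero_iff.1 (hK ξ hξ), map_zero]

end Conjugation

theorem inv_mem_slitPlane {z : ℂ} (hz : z ∈ Complex.slitPlane) : z⁻¹ ∈ Complex.slitPlane := by
  have h : 0 < Complex.normSq z := Complex.normSq_pos.2 (Complex.slitPlane_ne_zero hz)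
  rw [Complex.mem_slitPlane_iff, Complex.inv_re, Complex.inv_im]
  exact hz.imp (div_pos · h) fun him => div_ne_zero (neg_ne_zero.2 him) h.ne'

/-! ### Two-phase media in a Hilbert space -/

theorem inverse_eq_smul_resolvent {H : Type*} [NormedAddCommGroup H]
    [InnerProductSpace ℂ H] {T : H →L[ℂ] H} {s : ℂ} (hs : s ≠ 0)
    (hT : s ∉ spectrum ℂ T) :
    s⁻¹ • Ring.inverse (1 - s⁻¹ • T) = resolvent T s := by
  rw [spectrum.notMem_iff] at hT
  have h3 : (1 : H →L[ℂ] H) - s⁻¹ • T = (Units.mk0 _ (inv_ne_zero hs)) •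
      (algebraMap ℂ (H →L[ℂ] H) s - T) := by
    rw [Units.smul_mk0, smul_sub, Algebra.algebraMap_eq_smul_one, smul_smul, inv_mul_cancel₀ hs,
      one_smul]
  have hu : IsUnit ((1 : H →L[ℂ] H) - s⁻¹ • T) := h3 ▸ hT.smul _
  have h4 : (1 - s⁻¹ • T) * s • resolvent T s = 1 := by
    rw [h3, Units.smul_mk0, smul_mul_smul_comm, inv_mul_cancel₀ hs, one_smul]
    exact Ring.mul_inverse_cancel _ hT
  have h5 := congrArg (Ring.inverse (1 - s⁻¹ • T) * ·) h4
  beta_reduce at h5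
  rw [Ring.inverse_mul_cancel_left _ _ hu, mul_one] at h5
  rw [← h5, smul_smul, inv_mul_cancel₀ hs, one_smul]

section Abstract

variable {H : Type*} [NormedAddCommGroup H] [InnerProductSpace ℂ H] [CompleteSpace H]
  (K : Submodule ℂ H) [K.HasOrthogonalProjection] (X : H →L[ℂ] H)

/-- The operator `X Γ X`, where `Γ` is the orthogonal projection onto `K`. -/
def compression : H →L[ℂ] H := X ∘L K.starProjection ∘L X

theorem isSelfAdjoint_compression (hX : IsStarProjection X) :
    IsSelfAdjoint (compression K X) := by
  have h : star (X * (K.starProjection * X)) = X * (K.starProjection * X) := by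
    rw [star_mul, star_mul, hX.isSelfAdjoint.star_eq,
      (isStarProjection_starProjection (U := K)).isSelfAdjoint.star_eq, mul_assoc]
  exact h

theorem commute_compression (hX : IsStarProjection X) : Commute X (compression K X) := by
  change X * (X * (K.starProjection * X)) = X * (K.starProjection * X) * X
  rw [← mul_assoc, hX.isIdempotentElem.eq, mul_assoc, mul_assoc, hX.isIdempotentElem.eq]

theorem spectrum_compression (hX : IsStarProjection X) :
    spectrum ℂ (compression K X) ⊆ Complex.ofReal '' Set.Icc 0 1 :=
  spectrum_compression_subset hX isStarProjection_starProjection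

/-- Apart from the trivial case h = 1, failure would mean 1/(1 - h) = r with r ∈ (0,1], that is h =
1 - 1/r ≤ 0, which the slit plane excludes. -/
theorem isUnit_of_mem_slitPlane (hX : IsStarProjection X) {h : ℂ} (hh : h ∈ Complex.slitPlane) :
    IsUnit (1 - (1 - h) • compression K X) := by
  rcases eq_or_ne (1 - h) 0 with h0 | h0
  · rw [h0, zero_smul, sub_zero]
    exact isUnit_one
  have hs : (1 - h)⁻¹ ∉ spectrum ℂ (compression K X) := by
    intro hmem
    obtain ⟨r, ⟨h1, h2⟩, hr⟩ := spectrum_compression K X hX hmem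
    have hr' : h = ((1 - r⁻¹ : ℝ) : ℂ) := by
      push_cast
      rw [hr, inv_inv, sub_sub_cancel]
    rw [hr', Complex.ofReal_mem_slitPlane] at hh
    have hr0 : 0 < r := lt_of_le_of_ne h1 fun h3 => inv_ne_zero h0 (by rw [← hr, ← h3]; simp)
    linarith [(one_le_inv₀ hr0).2 h2]
  rw [spectrum.notMem_iff] at hs
  have h3 : (1 : H →L[ℂ] H) - (1 - h) • compression K X =
      (Units.mk0 _ h0) • (algebraMap ℂ (H →L[ℂ] H) (1 - h)⁻¹ - compression K X) := by
    rw [Units.smul_mk0, smul_sub, Algebra.algebraMap_eq_smul_one, smul_smul, mul_inv_cancel₀ h0,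
      one_smul]
  rw [h3]
  exact hs.smul _

/-- The field that solves the problem with the applied field `E₀`, for the medium with the
coefficients `h` on the range of `X` and `1` on its complement. -/
def solution (h : ℂ) (E₀ : H) : H :=
  E₀ + (1 - h) • K.starProjection (Ring.inverse (1 - (1 - h) • compression K X) (X E₀))

variable {K X}

/-- The equation defining y = (1 - (1 - h)XΓX)⁻¹XE₀ shows that y lies in the range of X. Hence ΓXy =
Γy, and the same equation becomes the claim. -/
theorem apply_solution (hX : IsStarProjection X) {h : ℂ} (hh : h ∈ Complex.slitPlane) (E₀ : H) :
    X (solution K X h E₀) = Ring.inverse (1 - (1 - h) • compression K X) (X E₀) := by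
  have hXX : ∀ x, X (X x) = X x := fun x => congrArg (· x) hX.isIdempotentElem.eq
  set y := Ring.inverse (1 - (1 - h) • compression K X) (X E₀) with hy
  have h1 : y - (1 - h) • X (K.starProjection (X y)) = X E₀ :=
    congrArg (· (X E₀)) (Ring.mul_inverse_cancel _ (isUnit_of_mem_slitPlane K X hX hh))
  have h2 : y = X E₀ + (1 - h) • X (K.starProjection (X y)) := sub_eq_iff_eq_add.1 h1
  have h3 : X y = y := by
    rw [h2, map_add, map_smul, hXX, hXX, ← h2]
  rw [solution, map_add, map_smul, ← hy]
  rw [h3] at h2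
  exact h2.symm

/-- Existence and uniqueness at once. Projecting the flux onto K turns the weak equation into F = (1
- h)ΓXE; applying X leaves a linear equation for XE alone, whose operator is invertible. -/
theorem eq_solution_iff (hX : IsStarProjection X) {h : ℂ} (hh : h ∈ Complex.slitPlane) {E₀ : H}
    (hE₀ : E₀ ∈ Kᗮ) (E : H) :
    ((∃ F ∈ K, E = E₀ + F) ∧ ∀ ξ ∈ K, inner ℂ ξ (E - (1 - h) • X E) = 0) ↔
      E = solution K X h E₀ := by
  have hXX : ∀ x, X (X x) = X x := fun x => congrArg (· x) hX.isIdempotentElem.eq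
  constructor
  · rintro ⟨⟨F, hF, rfl⟩, h2⟩
    have h3 : K.starProjection (E₀ + F - (1 - h) • X (E₀ + F)) = 0 :=
      (K.starProjection_apply_eq_zero_iff).2 h2
    have h4 : F = (1 - h) • K.starProjection (X (E₀ + F)) := by
      rw [map_sub, map_add, (K.starProjection_apply_eq_zero_iff).2 hE₀, zero_add, map_smul,
        Submodule.starProjection_eq_self_iff.2 hF, sub_eq_zero] at h3
      exact h3
    have h5 : (1 - (1 - h) • compression K X) (X (E₀ + F)) = X E₀ := by
      change X (E₀ + F) - (1 - h) • X (K.starProjection (X (X (E₀ + F)))) = X E₀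
      rw [hXX, ← map_smul, ← h4, ← map_sub, add_sub_cancel_right]
    have h6 : X (E₀ + F) = Ring.inverse (1 - (1 - h) • compression K X) (X E₀) := by
      rw [← h5]
      exact (congrArg (· (X (E₀ + F)))
        (Ring.inverse_mul_cancel _ (isUnit_of_mem_slitPlane K X hX hh))).symm
    rw [solution, ← h6, ← h4]
  · rintro rfl
    refine ⟨⟨_, K.smul_mem _ (K.starProjection_apply_mem _), rfl⟩, fun ξ hξ => ?_⟩
    rw [apply_solution hX hh, solution, add_sub_assoc, ← smul_sub, inner_add_right, hE₀ ξ hξ,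
      zero_add, inner_smul_right, K.inner_right_of_mem_orthogonal hξ, mul_zero]
    rw [← neg_sub]
    exact Kᗮ.neg_mem (K.sub_starProjection_mem_orthogonal _)

theorem inner_solution (hX : IsStarProjection X) {h : ℂ} (hh : h ∈ Complex.slitPlane) {E₀ e : H}
    (he : e ∈ Kᗮ) :
    inner ℂ e (solution K X h E₀ - (1 - h) • X (solution K X h E₀)) = inner ℂ e E₀ -
      (1 - h) * inner ℂ e (Ring.inverse (1 - (1 - h) • compression K X) (X E₀)) := by
  rw [apply_solution hX hh, inner_sub_right, inner_smul_right]
  congr 1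
  rw [solution, inner_add_right, inner_smul_right,
    K.inner_left_of_mem_orthogonal (K.starProjection_apply_mem _) he, mul_zero, add_zero]

/-- The flux is orthogonal to the fluctuation F, so E₀ may be replaced by E in the first slot. The
form becomes ‖E‖² - (1 - h)‖XE‖², with imaginary part Im h · ‖XE‖². -/
theorem im_inner_solution_nonneg (hX : IsStarProjection X) {h : ℂ} (hh : 0 < h.im) {E₀ : H}
    (hE₀ : E₀ ∈ Kᗮ) :
    0 ≤ (inner ℂ E₀ (solution K X h E₀ - (1 - h) • X (solution K X h E₀))).im := by
  obtain ⟨⟨F, hF, hE⟩, hort⟩ := (eq_solution_iff hX (Or.inr hh.ne') hE₀ _).2 rfl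
  set E := solution K X h E₀
  have h1 : inner ℂ E₀ (E - (1 - h) • X E) = inner ℂ E (E - (1 - h) • X E) := by
    conv_rhs => rw [hE, inner_add_left, ← hE, hort F hF, add_zero]
  have h2 : inner ℂ E (X E) = ((‖X E‖ ^ 2 : ℝ) : ℂ) := by
    have hXX : X (X E) = X E := congrArg (· E) hX.isIdempotentElem.eq
    rw [← hXX, ← ContinuousLinearMap.adjoint_inner_left, hX.isSelfAdjoint.adjoint_eq, hXX,
      inner_self_eq_norm_sq_to_K]
    push_cast
    rfl
  rw [h1, inner_sub_right, inner_smul_right, h2, inner_self_eq_norm_sq_to_K, Complex.sub_im,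
    Complex.im_mul_ofReal]
  have h3 : ((‖E‖ : ℂ) ^ 2).im = 0 := by
    rw [← Complex.ofReal_pow, Complex.ofReal_im]
  rw [show ((RCLike.ofReal ‖E‖ : ℂ) ^ 2).im = 0 from h3, Complex.sub_im, Complex.one_im]
  have := mul_nonneg hh.le (sq_nonneg ‖X E‖)
  linarith

end Abstract

/-! ### Effective coefficients -/

section Effective

variable {Ω : Type*} [MeasurableSpace Ω] {P : Measure Ω} [IsProbabilityMeasure P] {d : ℕ}
  (K : Submodule ℂ (Hvec P d)) [K.HasOrthogonalProjection] (X : Hvec P d →L[ℂ] Hvec P d)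

/-- The effective matrix of the medium `h X + (I - X)`, as a function of `h`. -/
def effective (h : ℂ) : Matrix (Fin d) (Fin d) ℂ := Matrix.of fun k j =>
  (if j = k then 1 else 0) - (1 - h) *
    inner ℂ (basisField P k) (Ring.inverse (1 - (1 - h) • compression K X) (X (basisField P j)))

variable {K X}

theorem effective_mulVec (h : ℂ) (c : Fin d → ℂ) (k : Fin d) :
    (effective K X h).mulVec c k = inner ℂ (basisField P k) (constField P c) - (1 - h) *
      inner ℂ (basisField P k)
        (Ring.inverse (1 - (1 - h) • compression K X) (X (constField P c))) := by
  have h1 : inner ℂ (basisField P k) (constField P c) = c k := by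
    rw [inner_basisField_left, mean_constField]
  rw [h1, constField_eq_sum P c]
  simp only [map_sum, map_smul, inner_sum, inner_smul_right, Matrix.mulVec, dotProduct, effective,
    Matrix.of_apply]
  rw [Finset.mul_sum, ← Finset.sum_ite_eq' Finset.univ k c |>.trans (if_pos (Finset.mem_univ k)),
    ← Finset.sum_sub_distrib]
  refine Finset.sum_congr rfl fun j _ => ?_
  split_ifs <;> ring

theorem mean_solution (hX : IsStarProjection X) (hK : ∀ c, constField P c ∈ Kᗮ) {h : ℂ}
    (hh : h ∈ Complex.slitPlane) (c : Fin d → ℂ) :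
    mean (solution K X h (constField P c) - (1 - h) • X (solution K X h (constField P c))) =
      (effective K X h).mulVec c := by
  ext k
  rw [← inner_basisField_left P, effective_mulVec]
  exact inner_solution hX hh (hK _)

theorem isHerglotz_effective (hX : IsStarProjection X) (hK : ∀ c, constField P c ∈ Kᗮ) :
    IsHerglotz (effective K X) := by
  refine ⟨fun k j h hh => DifferentiableAt.differentiableWithinAt ?_, fun h hh c => ?_⟩
  · have h1 : DifferentiableAt ℂ (fun h : ℂ => Ring.inverse (1 - (1 - h) • compression K X)) h :=
      DifferentiableAt.inverse (by fun_prop) (isUnit_of_mem_slitPlane K X hX hh)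
    have h2 : DifferentiableAt ℂ (fun h : ℂ => innerSL ℂ (basisField P k)
        (Ring.inverse (1 - (1 - h) • compression K X) (X (basisField P j)))) h :=
      (innerSL ℂ (basisField P k)).differentiableAt.comp h
        (h1.clm_apply (differentiableAt_const _))
    exact (differentiableAt_const _).sub (((differentiableAt_const _).sub differentiableAt_id).mul h2)
  · have h1 := im_inner_solution_nonneg hX hh (hK c)
    rw [inner_constField_left, mean_solution hX hK (Or.inr hh.ne')] at h1
    exact h1

theorem effective_spec (hX : IsStarProjection X) (hK : ∀ c, constField P c ∈ Kᗮ) {a b : ℂ}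
    (hb : b ≠ 0) (hab : a / b ∈ Complex.slitPlane) (c : Fin d → ℂ) :
    ∃ E : Hvec P d, (∀ E' : Hvec P d, ((∃ F ∈ K, E' = constField P c + F) ∧
        ∀ ξ ∈ K, inner ℂ ξ ((a • X + b • (1 - X)) E') = 0) ↔ E' = E) ∧
      mean ((a • X + b • (1 - X)) E) = (b • effective K X (a / b)).mulVec c := by
  have h1 : ∀ E, (a • X + b • (1 - X)) E = b • (E - (1 - a / b) • X E) := fun E => by
    change a • X E + b • (E - X E) = _
    rw [smul_sub, smul_sub, smul_smul, mul_sub, mul_div_cancel₀ _ hb, mul_one, sub_smul]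
    abel
  refine ⟨solution K X (a / b) (constField P c), fun E' => ?_, ?_⟩
  · rw [← eq_solution_iff hX hab (hK c)]
    refine and_congr_right fun _ => forall₂_congr fun ξ _ => ?_
    rw [h1, inner_smul_right, mul_eq_zero, or_iff_right hb]
  · rw [h1, mean_smul, mean_solution hX hK hab, Matrix.smul_mulVec]

/-- The same medium can be normalized by either coefficient, exchanging the roles of X and 1 - X.
Uniqueness of the field identifies the two solutions, so one matrix gives both effective functions.
-/
theorem exists_effective_matrix (hX : IsStarProjection X) (hK : ∀ c, constField P c ∈ Kᗮ)
    {a b : ℂ} (ha : a ≠ 0) (hb : b ≠ 0) (hab : a / b ∈ Complex.slitPlane) :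
    ∃ S : Matrix (Fin d) (Fin d) ℂ,
      (∀ c, ∃ E : Hvec P d, (∀ E' : Hvec P d, ((∃ F ∈ K, E' = constField P c + F) ∧
        ∀ ξ ∈ K, inner ℂ ξ ((a • X + b • (1 - X)) E') = 0) ↔ E' = E) ∧
        mean ((a • X + b • (1 - X)) E) = S.mulVec c) ∧
      effective K X (a / b) = b⁻¹ • S ∧ effective K (1 - X) (b / a) = a⁻¹ • S := by
  refine ⟨b • effective K X (a / b), effective_spec hX hK hb hab, ?_, ?_⟩
  · rw [smul_smul, inv_mul_cancel₀ hb, one_smul]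
  · have hba : b / a ∈ Complex.slitPlane := by
      rw [← inv_div]
      exact inv_mem_slitPlane hab
    rw [eq_inv_smul_iff₀ ha]
    refine Matrix.ext_of_mulVec_single fun j => ?_
    obtain ⟨E, hE, hmE⟩ := effective_spec hX hK hb hab (Pi.single j 1)
    obtain ⟨E', hE', hmE'⟩ := effective_spec hX.one_sub hK ha hba (Pi.single j 1)
    rw [sub_sub_cancel, add_comm] at hE' hmE'
    have : E = E' := (hE' E).1 ((hE E).2 rfl)
    rw [← hmE, ← hmE', this]

/-- With h = 1 - 1/s, the factor 1 - h times the inverse of 1 - (1 - h)T is exactly the resolvent at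
s; s ≠ 0 because 0 lies in the excluded interval. -/
theorem hasStieltjesRepresentation_effective (hX : IsStarProjection X)
    (hCX : ∀ ψ, conjField P (X ψ) = X (conjField P ψ))
    (hCK : ∀ ψ ∈ K, conjField P ψ ∈ K) :
    HasStieltjesRepresentation P X (compression K X) (effective K X) := by
  have hCT : ∀ ψ, conjField P (compression K X ψ) = compression K X (conjField P ψ) := fun ψ => by
    change conjField P (X (K.starProjection (X ψ))) = X (K.starProjection (X (conjField P ψ)))
    rw [hCX, map_starProjection_of_conj (inner_conjField P) (conjField_conjField P) hCK, hCX]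
  obtain ⟨Q, hQ, hQ1, μ, hμ, hμ0, hrep⟩ := exists_stieltjes_representation
    (isSelfAdjoint_compression K X hX) (spectrum_compression K X hX) hX
    (commute_compression K X hX) (continuous_conjField P) (inner_conjField P) hCT hCX
    (conjField_basisField P (d := d))
  refine ⟨isSelfAdjoint_compression K X hX, spectrum_compression K X hX, Q, hQ, hQ1, μ, hμ, hμ0,
    fun s hs j k => ⟨?_, hrep s hs j k⟩⟩
  have hs0 : s ≠ 0 := fun h => hs ⟨0, by simp, by simp [h]⟩
  rw [effective, Matrix.of_apply, sub_sub_cancel, one_div,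
    ← inverse_eq_smul_resolvent hs0 fun h => hs (spectrum_compression K X hX h),
    _root_.smul_apply, inner_smul_right]

end Effective

end

end Polycrystal

/-! ### The main theorem -/

theorem mainTheorem3 {Ω : Type*} [MeasurableSpace Ω] (P : Measure Ω) [IsProbabilityMeasure P]
    {d : ℕ} [NeZero d]
    [AddAction (Fin d → ℝ) Ω] [MeasurableConstVAdd (Fin d → ℝ) Ω]
    [ErgodicVAdd (Fin d → ℝ) Ω P]
    (hcont : ∀ f : Polycrystal.H0 P,
      Continuous fun x : Fin d → ℝ => Polycrystal.translate P x f)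
    (R : Polycrystal.Orientation Ω d) :
    ∃ (Γ Υ : Polycrystal.Hvec P d →L[ℂ] Polycrystal.Hvec P d)
      (m w m' w' : ℂ → Matrix (Fin d) (Fin d) ℂ),
      Polycrystal.IsGamma Γ ∧ Polycrystal.IsUpsilon Υ ∧
      (∀ σ₁ σ₂ : ℂ, σ₁ ≠ 0 → σ₂ ≠ 0 → σ₁ / σ₂ ∈ Complex.slitPlane →
        ∃ S S' : Matrix (Fin d) (Fin d) ℂ,
          Polycrystal.IsEffectiveConductivity P R σ₁ σ₂ S ∧
          Polycrystal.IsEffectiveResistivity P R σ₁ σ₂ S' ∧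
          m (σ₁ / σ₂) = σ₂⁻¹ • S ∧ w (σ₂ / σ₁) = σ₁⁻¹ • S ∧
          m' (σ₁ / σ₂) = σ₁ • S' ∧ w' (σ₂ / σ₁) = σ₂ • S') ∧
      (Polycrystal.IsHerglotz m ∧ Polycrystal.IsHerglotz w ∧
        Polycrystal.IsHerglotz m' ∧ Polycrystal.IsHerglotz w') ∧
      Polycrystal.HasStieltjesRepresentation P (Polycrystal.X1 P R)
        (Polycrystal.X1 P R ∘L Γ ∘L Polycrystal.X1 P R) m ∧
      Polycrystal.HasStieltjesRepresentation P (Polycrystal.X2 P R)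
        (Polycrystal.X2 P R ∘L Γ ∘L Polycrystal.X2 P R) w ∧
      Polycrystal.HasStieltjesRepresentation P (Polycrystal.X2 P R)
        (Polycrystal.X2 P R ∘L Υ ∘L Polycrystal.X2 P R) m' ∧
      Polycrystal.HasStieltjesRepresentation P (Polycrystal.X1 P R)
        (Polycrystal.X1 P R ∘L Υ ∘L Polycrystal.X1 P R) w' := by
  open Polycrystal in
  have hp1 := isStarProjection_X1 P R
  have hp2 := isStarProjection_X2 P R
  have hK : ∀ c, constField P c ∈ (curlFreeSub P d)ᗮ :=
    constField_mem_orthogonal fun ξ hξ => hξ.2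
  have hK' : ∀ c, constField P c ∈ (divFreeSub P d)ᗮ :=
    constField_mem_orthogonal fun ξ hξ => hξ.2
  refine ⟨(curlFreeSub P d).starProjection, (divFreeSub P d).starProjection,
    effective (curlFreeSub P d) (X1 P R), effective (curlFreeSub P d) (X2 P R),
    effective (divFreeSub P d) (X2 P R), effective (divFreeSub P d) (X1 P R),
    isGamma_starProjection hcont, isUpsilon_starProjection hcont, fun σ₁ σ₂ h1 h2 h => ?_,
    ⟨isHerglotz_effective hp1 hK, isHerglotz_effective hp2 hK, isHerglotz_effective hp2 hK',
      isHerglotz_effective hp1 hK'⟩,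
    hasStieltjesRepresentation_effective hp1 (conjField_op P R _)
      fun ψ hψ => conjField_mem_curlFreeSub hψ,
    hasStieltjesRepresentation_effective hp2 (conjField_op P R _)
      fun ψ hψ => conjField_mem_curlFreeSub hψ,
    hasStieltjesRepresentation_effective hp2 (conjField_op P R _)
      fun ψ hψ => conjField_mem_divFreeSub hψ,
    hasStieltjesRepresentation_effective hp1 (conjField_op P R _)
      fun ψ hψ => conjField_mem_divFreeSub hψ⟩
  obtain ⟨S, hS, hm, hw⟩ := exists_effective_matrix hp1 hK h1 h2 h
  have h' : σ₁⁻¹ / σ₂⁻¹ ∈ Complex.slitPlane := by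
    rw [inv_div_inv, ← inv_div]
    exact inv_mem_slitPlane h
  -- For the resistivity the coefficients are σ₁⁻¹ and σ₂⁻¹, so the ratio on X₁ is σ₂/σ₁ rather than
  -- σ₁/σ₂. This is why the function of z goes with X₁ and the function of h with X₂, opposite to
  -- the conductivity.
  obtain ⟨S', hS', hw', hm'⟩ :=
    exists_effective_matrix hp1 hK' (inv_ne_zero h1) (inv_ne_zero h2) h'
  rw [← X2_eq] at hS hw hS' hm'
  rw [inv_div_inv, inv_inv] at hw' hm'
  exact ⟨S, S', hS, hS', hm, hw, hm', hw'⟩
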